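/- **Setting.** Fix a horizon $T\ge 1$ and mean reward functions $\mu_1,\dots,\mu_T:[0,1]\to[0,1]$, chosen in advance, with $|\mu_t(x)-\mu_t(x')|\le|x-x'|$. In each round $t=1,\dots,T$ an algorithm plays an arm $x_t\in[0,1]$ and observes a reward $Y_t\in[0,1]$ whose conditional mean, given $x_t$ and the past, is $\mu_t(x_t)$. For $d\ge 0$ let $\mathcal T_d$ be the partition of $[0,1]$ into $2^d$ bins, i.e. intervals of length $2^{-d}$; the children of a bin at a depth $d'>d$ are the bins of $\mathcal T_{d'}$ contained in it. **The algorithm (Multi-Depth Bin Elimination), with a constant $c_0>0$ and the horizon $T$.** Time is divided into episodes, and each episode into successive blocks $m=1,2,\dots$; block $m$ lasts $8^m$ rounds unless its episode ends before. In each round $t$ there is a finite set $\mathcal D_t$ of active depths and, for each $d\in\mathcal D_t$, a set $\mathcal B_t(d)\subseteq\mathcal T_d$ of active bins. * *Blocks and replays.* When block $m$ starts, in round $\tau$, one sets $\mathcal D_\tau=\{m\}$ and $\mathcal B_\tau(m)=\mathcal T_m$, and independent Bernoulli variables $R_{s,d}$, independent of the past, are drawn for $\tau<s<\tau+8^m$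 and $0\le d<m$, with $\mathbb P(R_{s,d}=1)=\sqrt{8^d/(s-\tau)}$ if $8^d$ divides $s-\tau$ and $R_{s,d}=0$ otherwise. If $R_{s,d}=1$, a replay at depth $d$ starts in round $s$ of the block: $d$ becomes active with $\mathcal B_s(d)=\mathcal T_d$. It lasts $8^d$ rounds, unless the block ends before; then $d$ is deactivated, unless a new replay at depth $d$ starts at that moment. * *Sampling.* In round $t$, given the past, a bin is drawn uniformly from $\mathcal B_t(\min\mathcal D_t)$. Then one goes through the remaining active depths $d$ in increasing order: as long as the current bin has children in $\mathcal B_t(d)$, it is replaced by one of them, drawn uniformly; at the first depth where it has none, or after the last active depth, one stops. The arm $x_t$ is drawn uniformly from the current bin. * *Estimates.* Let $\mathcal F_t$ be the $\sigma$-algebra generated by everything drawn and observed in the rounds $1,\dots,t$ and $\mathbb E_{t-1}=\mathbb E[\,\cdot\mid\mathcal F_{t-1}]$. For a bin $B$ put $\hat\mu_t(B)=\frac{Y_t}{\mathbb P(x_t\in B\mid\mathcal F_{t-1})}\mathbf 1\{x_t\in B\}$, and for bins $B,B'$ of the same depth $\hat\delta_t(B',B)=\hat\mu_t(B')-\hat\mu_t(B)$.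 For an interval of rounds $[s_1,s_2]$ let $\mathcal B_{[s_1,s_2]}(d)=\bigcap_{s=s_1}^{s_2}\mathcal B_s(d)$. * *Eviction.* At the end of round $t$, a bin $B\in\mathcal B_t(d)$, $d\in\mathcal D_t$, is evicted, together with all its children at the deeper active depths, if for some interval of rounds $[s_1,s_2]$ between the start of the replay running at depth $d$ (the start of the block, for $d=m$) and $t$, $$\max_{B'\in\mathcal B_{[s_1,s_2]}(d)}\sum_{s=s_1}^{s_2}\hat\delta_s(B',B)>c_0\log(T)\sqrt{(s_2-s_1)2^d\vee 4^d}+\frac{4(s_2-s_1)}{2^d}.$$ If no bin of depth $m$ is left active in block $m$, then the episode ends, and round $t+1$ starts a new episode with its block $1$. **Proposition.** There is a numerical constant $c_1>0$ (independent of $T$, $(\mu_t)_t$, the reward distributions and $c_0$) such that, with probability at least $1-1/T^3$, the following holds simultaneously for all intervals $[s_1,s_2]\subseteq[1,T]$ of rounds, all depths $d\in\bigcap_{t=s_1}^{s_2}\mathcal D_t$ and all bins $B,B'\in\mathcal B_{[s_1,s_2]}(d)$: $$\left|\sum_{t=s_1}^{s_2}\hat\delta_t(B',B)-\sum_{t=s_1}^{s_2}\mathbb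 E_{t-1}\big[\hat\delta_t(B',B)\big]\right|\le c_1\log(T)\sqrt{(s_2-s_1)2^d\vee 4^d}.$$ -/

import Mathlib

open MeasureTheory ProbabilityTheory

noncomputable section

namespace MDBE

/-! ### Dyadic bins -/

/-- The bin number `k` (for `k < 2 ^ d`) of the partition of `[0, 1]` into `2 ^ d` intervals of
length `1 / 2 ^ d`; the bins are half-open, except that the last one contains the point `1`. -/
def bin (d k : ℕ) : Set ℝ :=
  if k + 1 = 2 ^ d then Set.Icc ((k : ℝ) / 2 ^ d) (((k : ℝ) + 1) / 2 ^ d)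
  else Set.Ico ((k : ℝ) / 2 ^ d) (((k : ℝ) + 1) / 2 ^ d)

/-- The number of the parent at depth `d' ≤ d` of the bin number `k` of depth `d`. -/
def parent (d d' k : ℕ) : ℕ := k / 2 ^ (d - d')

/-! ### The environment -/

/-- Mean reward functions of rounds `1, …, T` on the arm space `[0, 1]`: `[0, 1]`-valued and
`1`-Lipschitz.  They are fixed in advance (oblivious adversary). -/
structure IsLipschitzEnv (T : ℕ) (mean : ℕ → ℝ → ℝ) : Prop where
  mem_Icc : ∀ t ∈ Finset.Icc 1 T, ∀ x ∈ Set.Icc (0 : ℝ) 1, mean t x ∈ Set.Icc (0 : ℝ) 1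
  lipschitz : ∀ t ∈ Finset.Icc 1 T, ∀ x ∈ Set.Icc (0 : ℝ) 1, ∀ x' ∈ Set.Icc (0 : ℝ) 1,
    |mean t x - mean t x'| ≤ |x - x'|

/-! ### State of the algorithm -/

/-- State of the algorithm in a round, at the moment when the arm is drawn. -/
structure Config where
  /-- first round of the current block -/
  start : ℕ
  /-- number `m` of the current block, which is also its finest depth -/
  level : ℕ
  /-- first round of the replay running at a given depth, `none` if the depth is not active -/
  replayStart : ℕ → Option ℕ
  /-- (numbers of) the active bins of a given depth -/
  bins : ℕ → Finset ℕ

/-- The active depths, in increasing order. -/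
def Config.depthList (c : Config) : List ℕ :=
  (List.range (c.level + 1)).filter fun d => (c.replayStart d).isSome

/-- The set of active depths. -/
def Config.depths (c : Config) : Finset ℕ := c.depthList.toFinset

/-- State at the first round `t` of a block number `m`: the depth `m` alone is active, with all
its bins. -/
def fresh (t m : ℕ) : Config where
  start := t
  level := m
  replayStart d := if d = m then some t else none
  bins d := if d = m then Finset.range (2 ^ m) else ∅

/-- Placeholder for the time before round `1`: nothing is active. -/
def idle : Config where
  start := 0
  level := 0
  replayStart _ := none
  bins _ := ∅

/-! ### Sampling scheme -/

/-- The active bins of depth `d'` which are children of the bin number `k` of depth `d`. -/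
def activeChildren (c : Config) (d k d' : ℕ) : Finset ℕ :=
  (c.bins d').filter fun j => parent d' d j = k

/-- Law of the arm when the procedure has reached the bin number `k` of depth `d` and the list
contains the deeper active depths: as long as the current bin has active children at the next
active depth, move to one of these chosen uniformly at random; otherwise, and when there is no
further active depth, draw the arm uniformly from the current bin. -/
def descend (c : Config) : List ℕ → ℕ → ℕ → Measure ℝ
  | [], d, k => ProbabilityTheory.cond volume (bin d k)
  | d' :: ds, d, k =>
      if activeChildren c d k d' = ∅ then ProbabilityTheory.cond volume (bin d k)
      else ((activeChildren c d k d').card : ENNReal)⁻¹ •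
        ∑ j ∈ activeChildren c d k d', descend c ds d' j

/-- Law of the arm in state `c`.  The descent starts from the whole arm space (the bin of depth
`0`), so that its first step chooses uniformly among all active bins of the least active depth. -/
def armLaw (c : Config) : Measure ℝ := descend c c.depthList 0 0

/-! ### Trajectories and estimates -/

/-- A trajectory of the interaction.  `coin τ k d` is the replay variable of depth `d` for the
round `τ + k`, drawn in round `τ`; it is used only if a block starts in round `τ`. -/
structure Play where
  coin : ℕ → ℕ → ℕ → Bool
  arm : ℕ → ℝ
  reward : ℕ → ℝ

open Classical in
/-- Importance-weighted estimate in round `t` of the mean reward of the bin number `k` of depth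
`d`, when the table `tbl` contains the states of the rounds. -/
def muHatOf (h : Play) (tbl : ℕ → Config) (t d k : ℕ) : ℝ :=
  if h.arm t ∈ bin d k then h.reward t / (armLaw (tbl t)).real (bin d k) else 0

/-! ### Eviction and transition from one round to the next -/

/-- The eviction criterion at the end of round `t` for the bin number `k` of the active depth `d`:
on some interval `[s₁, s₂]` of rounds of the replay running at depth `d`, some bin `k'` active
throughout `[s₁, s₂]` has an estimated cumulative advantage over `k` above the threshold. -/
def Criterion (c₀ : ℝ) (T : ℕ) (h : Play) (tbl : ℕ → Config) (t d k : ℕ) : Prop :=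
  ∃ s₀ ∈ (tbl t).replayStart d, ∃ s₁ s₂ : ℕ, s₀ ≤ s₁ ∧ s₁ ≤ s₂ ∧ s₂ ≤ t ∧
    ∃ k' : ℕ, (∀ s ∈ Finset.Icc s₁ s₂, k' ∈ (tbl s).bins d) ∧
      c₀ * Real.log T * Real.sqrt (max (((s₂ : ℝ) - s₁) * 2 ^ d) (4 ^ d))
          + 4 * ((s₂ : ℝ) - s₁) / 2 ^ d
        < ∑ s ∈ Finset.Icc s₁ s₂, (muHatOf h tbl s d k' - muHatOf h tbl s d k)

/-- The bin number `k` of depth `d` is evicted at the end of round `t`: it or one of its parents at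
an active depth is an active bin which satisfies the criterion. -/
def Evicted (c₀ : ℝ) (T : ℕ) (h : Play) (tbl : ℕ → Config) (t d k : ℕ) : Prop :=
  ∃ d₀ ≤ d, d₀ ∈ (tbl t).depths ∧ parent d d₀ k ∈ (tbl t).bins d₀ ∧
    Criterion c₀ T h tbl t d₀ (parent d d₀ k)

open Classical in
/-- The bins of depth `d` still active after the evictions at the end of round `t`. -/
def kept (c₀ : ℝ) (T : ℕ) (h : Play) (tbl : ℕ → Config) (t d : ℕ) : Finset ℕ :=
  ((tbl t).bins d).filter fun k => ¬ Evicted c₀ T h tbl t d k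

/-- In the block of state `c`, a replay at depth `d` is triggered in round `t`. -/
def Triggered (h : Play) (c : Config) (t d : ℕ) : Prop :=
  d < c.level ∧ 8 ^ d ∣ t - c.start ∧ h.coin c.start (t - c.start) d = true

/-- The replay running at depth `d` in state `c`, if any, is over in round `t`. -/
def Ended (c : Config) (t d : ℕ) : Prop :=
  ∃ s ∈ c.replayStart d, s + 8 ^ d ≤ t

open Classical in
/-- The state in round `t + 1`, given the table of the states of the rounds up to `t`.  If no bin
of the finest depth is left (the MASTER set is empty), a new episode starts, with block `1`; if
the block has lasted `8 ^ m` rounds, block `m + 1` starts; otherwise the block goes on, replays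
which are triggered start with all bins of their depth, and replays which are over are removed. -/
def next (c₀ : ℝ) (T : ℕ) (h : Play) (tbl : ℕ → Config) (t : ℕ) : Config :=
  let c := tbl t
  if kept c₀ T h tbl t c.level = ∅ then fresh (t + 1) 1
  else if t + 1 = c.start + 8 ^ c.level then fresh (t + 1) (c.level + 1)
  else
    { start := c.start
      level := c.level
      replayStart := fun d =>
        if Triggered h c (t + 1) d then some (t + 1)
        else if Ended c (t + 1) d then none
        else c.replayStart d
      bins := fun d =>
        if Triggered h c (t + 1) d then Finset.range (2 ^ d)
        else if Ended c (t + 1) d then ∅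
        else kept c₀ T h tbl t d }

/-- `table c₀ T h t` contains the states of the rounds `1, …, t` along the trajectory `h`.  Since
nothing is active before round `1`, that round starts the first block of the first episode. -/
def table (c₀ : ℝ) (T : ℕ) (h : Play) : ℕ → ℕ → Config
  | 0 => fun _ => idle
  | t + 1 => Function.update (table c₀ T h t) (t + 1) (next c₀ T h (table c₀ T h t) t)

/-- The state in round `t ≥ 1`; it depends only on what happened before round `t`. -/
def config (c₀ : ℝ) (T : ℕ) (h : Play) (t : ℕ) : Config := table c₀ T h t t

/-- Importance-weighted estimate in round `t` of the mean reward of the bin `k` of depth `d`. -/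
def muHat (c₀ : ℝ) (T : ℕ) (h : Play) (t d k : ℕ) : ℝ := muHatOf h (config c₀ T h) t d k

/-- Estimated gap in round `t` between the bins `k'` and `k` of depth `d`. -/
def deltaHat (c₀ : ℝ) (T : ℕ) (h : Play) (t d k' k : ℕ) : ℝ :=
  muHat c₀ T h t d k' - muHat c₀ T h t d k

/-! ### The random interaction -/

/-- The probability that a replay at depth `d` is triggered `k` rounds after the start of a
block. -/
def replayProb (k d : ℕ) : ℝ := if 8 ^ d ∣ k then Real.sqrt (8 ^ d / (k : ℝ)) else 0

section Interaction

variable {Ω : Type*}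

/-- The σ-algebra generated by the replay variables drawn in round `t`. -/
abbrev coinSigma (H : Ω → Play) (t : ℕ) : MeasurableSpace Ω :=
  MeasurableSpace.comap (fun ω => (H ω).coin t) inferInstance

/-- The σ-algebra generated by the arm played in round `t`. -/
abbrev armSigma (H : Ω → Play) (t : ℕ) : MeasurableSpace Ω :=
  MeasurableSpace.comap (fun ω => (H ω).arm t) inferInstance

/-- The σ-algebra generated by the reward observed in round `t`. -/
abbrev rewardSigma (H : Ω → Play) (t : ℕ) : MeasurableSpace Ω :=
  MeasurableSpace.comap (fun ω => (H ω).reward t) inferInstance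

/-- The natural filtration: everything that was drawn or observed in the rounds `1, …, t`. -/
abbrev hist (H : Ω → Play) (t : ℕ) : MeasurableSpace Ω :=
  ⨆ s ∈ Finset.Icc 1 t, coinSigma H s ⊔ armSigma H s ⊔ rewardSigma H s

/-- `H` is the random trajectory, on the probability space `(Ω, P)`, of the algorithm with constant
`c₀` and horizon `T` in an environment with the mean rewards `mean`: in each round, fresh
independent replay variables with the prescribed probabilities are drawn, then the arm is drawn
from the law prescribed by the sampling scheme in the current state, then a reward in `[0, 1]`
is observed whose conditional mean is the mean reward of the arm. -/
structure IsRun [MeasurableSpace Ω] (c₀ : ℝ) (T : ℕ) (mean : ℕ → ℝ → ℝ) (P : Measure Ω)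
    (H : Ω → Play) : Prop where
  measurable_coin : ∀ t, Measurable fun ω => (H ω).coin t
  measurable_arm : ∀ t, Measurable fun ω => (H ω).arm t
  measurable_reward : ∀ t, Measurable fun ω => (H ω).reward t
  coin_indep_past : ∀ t ∈ Finset.Icc 1 T, Indep (coinSigma H t) (hist H (t - 1)) P
  coin_indep : ∀ t ∈ Finset.Icc 1 T,
    iIndepFun (fun (i : ℕ × ℕ) (ω : Ω) => (H ω).coin t i.1 i.2) P
  coin_prob : ∀ t ∈ Finset.Icc 1 T, ∀ k d : ℕ, 1 ≤ k →
    P.real {ω | (H ω).coin t k d = true} = replayProb k d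
  arm_law : ∀ t ∈ Finset.Icc 1 T, ∀ A : Set ℝ, MeasurableSet A →
    P[Set.indicator {ω | (H ω).arm t ∈ A} (fun _ => (1 : ℝ)) | hist H (t - 1) ⊔ coinSigma H t]
      =ᵐ[P] fun ω => (armLaw (config c₀ T (H ω) t)).real A
  reward_mem : ∀ t ∈ Finset.Icc 1 T, ∀ᵐ ω ∂P, (H ω).reward t ∈ Set.Icc (0 : ℝ) 1
  reward_mean : ∀ t ∈ Finset.Icc 1 T,
    P[fun ω => (H ω).reward t | hist H (t - 1) ⊔ coinSigma H t ⊔ armSigma H t]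
      =ᵐ[P] fun ω => mean t ((H ω).arm t)

/-- The concentration event with constant `c₁`: for all intervals `[s₁, s₂]` of rounds, all depths
active throughout `[s₁, s₂]` and all pairs of bins of this depth active throughout `[s₁, s₂]`, the
cumulative estimated gap is close to the sum of the conditional expectations. -/
def concentrationEvent [MeasurableSpace Ω] (c₀ c₁ : ℝ) (T : ℕ) (P : Measure Ω) (H : Ω → Play) :
    Set Ω :=
  {ω | ∀ s₁ s₂ : ℕ, 1 ≤ s₁ → s₁ ≤ s₂ → s₂ ≤ T →
    ∀ d : ℕ, (∀ t ∈ Finset.Icc s₁ s₂, d ∈ (config c₀ T (H ω) t).depths) →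
    ∀ k k' : ℕ, (∀ t ∈ Finset.Icc s₁ s₂, k ∈ (config c₀ T (H ω) t).bins d) →
      (∀ t ∈ Finset.Icc s₁ s₂, k' ∈ (config c₀ T (H ω) t).bins d) →
      |∑ t ∈ Finset.Icc s₁ s₂, deltaHat c₀ T (H ω) t d k' k
          - ∑ t ∈ Finset.Icc s₁ s₂,
              (P[fun ω' => deltaHat c₀ T (H ω') t d k' k | hist H (t - 1)]) ω|
        ≤ c₁ * Real.log T * Real.sqrt (max (((s₂ : ℝ) - s₁) * 2 ^ d) (4 ^ d))}

end Interaction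

end MDBE

end

/-!
The increment of round `t` of the sum is, up to its conditional mean, an importance-weighted
estimate whose weight is the inverse of the conditional probability `p` of playing a bin.  Hence
its size is at most `1 / p` and its conditional second moment is of order `1 / p` as well, and all
depends on the bound `p ≥ 2⁻ᵈ` for active bins of depth `d` (`MDBE.le_armLaw_bin`).

This bound holds because the parents of an active bin are active at all coarser active depths
(`MDBE.regular_config`): evictions propagate to children, and a replay at depth `d` starts at a
multiple of `8 ^ d` rounds of its block, when every replay at a smaller depth is over or starts
anew.  So the descent can reach an active bin through its ancestors, and each step from depth `d'`
to depth `d''` chooses among at most `2 ^ (d'' - d')` children.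

Since the conditional second moments have a deterministic bound, Freedman's inequality is only
needed in the form of an exponential supermartingale with the deterministic compensator `v` per
round (`MDBE.measureReal_le_abs_sum_sub_condExp_le`), with increments rescaled by
`√((s₂ - s₁) 2ᵈ ∨ 4ᵈ)`.  The intervals, depths and bins of the claim are random only through the
condition of being active.  This condition is decided before each round, because the state of
round `t` is measurable with respect to the past (`MDBE.countablyMeasurable_config`), so it can be
put as an indicator into the increments.  A union bound over the `O(T⁵)` possible comparisons
concludes: in round `t` an active depth satisfies `2 ^ d ≤ 2 * t`, because a block of depth `m ≥ 2`
follows a block of `8 ^ (m - 1)` rounds.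
-/

namespace MDBE

/-! ### Dyadic bins -/

lemma measurableSet_bin (d k : ℕ) : MeasurableSet (bin d k) := by
  unfold bin
  split_ifs
  exacts [measurableSet_Icc, measurableSet_Ico]

lemma volume_bin (d k : ℕ) : volume (bin d k) = ENNReal.ofReal (1 / 2 ^ d) := by
  unfold bin
  split_ifs <;> simp only [Real.volume_Icc, Real.volume_Ico] <;> congr 1 <;> ring

lemma cond_bin_self (d k : ℕ) : ProbabilityTheory.cond volume (bin d k) (bin d k) = 1 := by
  rw [cond_apply (measurableSet_bin d k), Set.inter_self, volume_bin]
  exact ENNReal.inv_mul_cancel (by simp) ENNReal.ofReal_ne_top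

lemma parent_self (d k : ℕ) : parent d d k = k := by simp [parent]

lemma parent_parent {d₀ d₁ d₂ : ℕ} (h₀ : d₀ ≤ d₁) (h₁ : d₁ ≤ d₂) (k : ℕ) :
    parent d₁ d₀ (parent d₂ d₁ k) = parent d₂ d₀ k := by
  unfold parent
  rw [Nat.div_div_eq_div_mul, ← pow_add]
  congr 2
  omega

lemma parent_lt {d d' k : ℕ} (h : d' ≤ d) (hk : k < 2 ^ d) : parent d d' k < 2 ^ d' := by
  unfold parent
  rw [Nat.div_lt_iff_lt_mul (by positivity), ← pow_add]
  rwa [Nat.add_sub_cancel' h]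

lemma bin_subset_bin_parent {d d' k : ℕ} (h : d' ≤ d) (hk : k < 2 ^ d) :
    bin d k ⊆ bin d' (parent d d' k) := by
  obtain ⟨e, rfl⟩ := Nat.exists_eq_add_of_le h
  have hpar : parent (d' + e) d' k = k / 2 ^ e := by simp [parent]
  have hlt := parent_lt h hk
  rw [hpar] at hlt ⊢
  have h2e : 0 < 2 ^ e := by positivity
  have hlo : k / 2 ^ e * 2 ^ e ≤ k := Nat.div_mul_le_self _ _
  have hhi : k + 1 ≤ (k / 2 ^ e + 1) * 2 ^ e := by
    have := Nat.lt_div_mul_add (a := k) h2e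
    rw [add_mul]; omega
  have hlo' : ((k / 2 ^ e : ℕ) : ℝ) / 2 ^ d' ≤ (k : ℝ) / 2 ^ (d' + e) := by
    rw [div_le_div_iff₀ (by positivity) (by positivity), pow_add]
    have : ((k / 2 ^ e : ℕ) : ℝ) * 2 ^ e ≤ k := by exact_mod_cast hlo
    nlinarith [show (0 : ℝ) < 2 ^ d' by positivity]
  have hhi' : ((k : ℝ) + 1) / 2 ^ (d' + e) ≤ (((k / 2 ^ e : ℕ) : ℝ) + 1) / 2 ^ d' := by
    rw [div_le_div_iff₀ (by positivity) (by positivity), pow_add]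
    have : (k : ℝ) + 1 ≤ (((k / 2 ^ e : ℕ) : ℝ) + 1) * 2 ^ e := by exact_mod_cast hhi
    nlinarith [show (0 : ℝ) < 2 ^ d' by positivity]
  unfold bin
  split_ifs with h1 h2 h2
  · exact Set.Icc_subset_Icc hlo' hhi'
  · -- the last bin of the deeper partition lies in the last bin of the coarser one
    exfalso
    rw [h1, pow_add] at hhi
    have := Nat.le_of_mul_le_mul_right hhi h2e
    omega
  · exact Set.Ico_subset_Icc_self.trans (Set.Icc_subset_Icc hlo' hhi')
  · exact Set.Ico_subset_Ico hlo' hhi'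

/-! ### Probability that the sampling scheme plays a given active bin -/

lemma mem_depthList {c : Config} {d : ℕ} :
    d ∈ c.depthList ↔ d ≤ c.level ∧ (c.replayStart d).isSome := by
  simp [Config.depthList]

lemma mem_depths {c : Config} {d : ℕ} :
    d ∈ c.depths ↔ d ≤ c.level ∧ (c.replayStart d).isSome := by
  rw [Config.depths, List.mem_toFinset, mem_depthList]

lemma descend_univ_le_one (c : Config) (l : List ℕ) (d k : ℕ) :
    descend c l d k Set.univ ≤ 1 := by
  induction l generalizing d k with
  | nil =>
    rw [descend]
    exact prob_le_one
  | cons d' ds ih =>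
    rw [descend]
    split_ifs with h
    · exact prob_le_one
    · simp only [Measure.smul_apply, Measure.coe_finsetSum, Finset.sum_apply, smul_eq_mul]
      calc _ ≤ ((activeChildren c d k d').card : ENNReal)⁻¹ *
            ∑ j ∈ activeChildren c d k d', 1 := by gcongr; exact ih _ _
        _ ≤ 1 := by
          simp only [Finset.sum_const, nsmul_eq_mul, mul_one]
          exact ENNReal.inv_mul_le_one _

instance isFiniteMeasure_armLaw (c : Config) : IsFiniteMeasure (armLaw c) :=
  ⟨(descend_univ_le_one c _ _ _).trans_lt ENNReal.one_lt_top⟩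

/-- The descent never leaves the bin that it has reached. -/
lemma one_le_descend_self (c : Config) (hbins : ∀ d k, k ∈ c.bins d → k < 2 ^ d) (l : List ℕ)
    (d k : ℕ) (hl : (d :: l).Pairwise (· ≤ ·)) : 1 ≤ descend c l d k (bin d k) := by
  induction l generalizing d k with
  | nil => exact (cond_bin_self d k).ge
  | cons d' ds ih =>
    rw [descend]
    split_ifs with h
    · exact (cond_bin_self d k).ge
    · simp only [Measure.smul_apply, Measure.coe_finsetSum, Finset.sum_apply, smul_eq_mul]
      have hcard : ((activeChildren c d k d').card : ENNReal) ≠ 0 := by simpa using h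
      calc (1 : ENNReal) = ((activeChildren c d k d').card : ENNReal)⁻¹ *
            ∑ j ∈ activeChildren c d k d', 1 := by
              rw [Finset.sum_const, nsmul_eq_mul, mul_one,
                ENNReal.inv_mul_cancel hcard (ENNReal.natCast_ne_top _)]
        _ ≤ _ := by
          gcongr with j hj
          simp only [activeChildren, Finset.mem_filter] at hj
          refine (ih d' j hl.of_cons).trans (measure_mono ?_)
          rw [← hj.2]
          exact bin_subset_bin_parent (List.rel_of_pairwise_cons hl (by simp)) (hbins _ _ hj.1)

lemma card_activeChildren_le (c : Config) (d k d' : ℕ) :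
    (activeChildren c d k d').card ≤ 2 ^ (d' - d) := by
  have hsub : activeChildren c d k d' ⊆
      Finset.Ico (k * 2 ^ (d' - d)) (k * 2 ^ (d' - d) + 2 ^ (d' - d)) := by
    intro j hj
    rw [activeChildren, Finset.mem_filter, parent] at hj
    have h2 : 0 < 2 ^ (d' - d) := by positivity
    have h1 := Nat.div_mul_le_self j (2 ^ (d' - d))
    have h3 := Nat.lt_div_mul_add (a := j) h2
    rw [hj.2] at h1 h3
    exact Finset.mem_Ico.2 ⟨h1, h3⟩
  simpa using Finset.card_le_card hsub

/-- If all the ancestors of an active bin of depth `d` are active, then the descent from one of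
them reaches this bin with at least the probability of the uniform law: each step chooses among
at most `2 ^ (d'' - d')` children. -/
lemma le_descend (c : Config) (hbins : ∀ d k, k ∈ c.bins d → k < 2 ^ d) (d k : ℕ)
    (l : List ℕ) (e : ℕ) (hl : (e :: l).Pairwise (· ≤ ·)) (hd : d ∈ e :: l)
    (hpar : ∀ d' ∈ l, d' ≤ d → parent d d' k ∈ c.bins d') :
    ((2 : ENNReal) ^ (d - e))⁻¹ ≤ descend c l e (parent d e k) (bin d k) := by
  have hed : e ≤ d := by
    rcases List.mem_cons.1 hd with rfl | hd'
    · exact le_rfl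
    · exact List.rel_of_pairwise_cons hl hd'
  rcases hed.eq_or_lt with rfl | hlt
  · simpa [parent_self] using one_le_descend_self c hbins l e k hl
  induction l generalizing e with
  | nil => simp at hd; omega
  | cons d' ds ih =>
    have hd' : d ∈ d' :: ds := by
      rcases List.mem_cons.1 hd with rfl | h
      · omega
      · exact h
    have hed' : e ≤ d' := List.rel_of_pairwise_cons hl (by simp)
    have hd'd : d' ≤ d := by
      rcases List.mem_cons.1 hd' with rfl | h
      · exact le_rfl
      · exact List.rel_of_pairwise_cons hl.of_cons h
    have hrec : ((2 : ENNReal) ^ (d - d'))⁻¹ ≤ descend c ds d' (parent d d' k) (bin d k) := by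
      rcases hd'd.eq_or_lt with rfl | hlt'
      · simpa [parent_self] using one_le_descend_self c hbins ds d' k hl.of_cons
      · exact ih d' hl.of_cons hd' (fun x hx => hpar x (List.mem_cons_of_mem _ hx)) hd'd hlt'
    have hmem : parent d d' k ∈ activeChildren c e (parent d e k) d' := by
      simp only [activeChildren, Finset.mem_filter]
      exact ⟨hpar d' (by simp) hd'd, parent_parent hed' hd'd k⟩
    rw [descend, if_neg (Finset.ne_empty_of_mem hmem)]
    simp only [Measure.smul_apply, Measure.coe_finsetSum, Finset.sum_apply, smul_eq_mul]
    calc ((2 : ENNReal) ^ (d - e))⁻¹ = ((2 : ENNReal) ^ (d' - e))⁻¹ * (2 ^ (d - d'))⁻¹ := by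
          rw [← ENNReal.mul_inv (by simp) (by simp), ← pow_add]
          congr 2
          omega
      _ ≤ ((activeChildren c e (parent d e k) d').card : ENNReal)⁻¹ *
          descend c ds d' (parent d d' k) (bin d k) := by
        gcongr
        exact_mod_cast card_activeChildren_le c e (parent d e k) d'
      _ ≤ _ := by
        gcongr
        exact Finset.single_le_sum (f := fun j => descend c ds d' j (bin d k))
          (fun _ _ => zero_le) hmem

/-! ### Structural properties of the states -/

/-- Properties shared by the states of all rounds `t ≥ 1`. -/
structure Config.Regular (c : Config) (t : ℕ) : Prop where
  start_le : c.start ≤ t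
  /-- The preceding block of the episode, if any, lasted `8 ^ (level - 1)` rounds. -/
  pow_level_le : 8 ^ (c.level - 1) ≤ c.start
  lt_of_mem_bins : ∀ d k, k ∈ c.bins d → k < 2 ^ d
  /-- Replays at depth `d` start after a multiple of `8 ^ d` rounds of the block. -/
  aligned : ∀ d < c.level, ∀ s ∈ c.replayStart d, c.start ≤ s ∧ s ≤ t ∧ 8 ^ d ∣ s - c.start
  /-- The parents of active bins are active. -/
  parent_mem : ∀ d d' k, d' ≤ d → d ∈ c.depths → d' ∈ c.depths → k ∈ c.bins d →
    parent d d' k ∈ c.bins d'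

lemma Config.Regular.fresh {t m : ℕ} (h : 8 ^ (m - 1) ≤ t) : (fresh t m).Regular t where
  start_le := le_rfl
  pow_level_le := h
  lt_of_mem_bins d k hk := by
    simp only [MDBE.fresh] at hk
    split_ifs at hk with hd
    · simpa [hd] using hk
    · simp at hk
  aligned d hd s hs := by
    simp only [MDBE.fresh] at hd hs
    simp [hd.ne] at hs
  parent_mem d d' k _ hd hd' hk := by
    have hactive : ∀ e ∈ (MDBE.fresh t m).depths, e = m := by
      intro e he
      by_contra hne
      simp [mem_depths, MDBE.fresh, hne] at he
    rw [hactive d hd] at hk ⊢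
    rwa [hactive d' hd', parent_self]

open Classical in
lemma mem_kept {c₀ : ℝ} {T : ℕ} {h : Play} {tbl : ℕ → Config} {t d k : ℕ} :
    k ∈ kept c₀ T h tbl t d ↔ k ∈ (tbl t).bins d ∧ ¬ Evicted c₀ T h tbl t d k :=
  Finset.mem_filter

/-- Eviction is inherited by children. -/
lemma Evicted.of_parent {c₀ : ℝ} {T : ℕ} {h : Play} {tbl : ℕ → Config} {t d d' k : ℕ}
    (hd : d' ≤ d) (he : Evicted c₀ T h tbl t d' (parent d d' k)) :
    Evicted c₀ T h tbl t d k := by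
  obtain ⟨d₀, h₀, hact, hmem, hcrit⟩ := he
  rw [parent_parent h₀ hd] at hmem hcrit
  exact ⟨d₀, h₀.trans hd, hact, hmem, hcrit⟩

/-- A transition preserves regularity.  The point is that a new replay at depth `d` starts at a
multiple of `8 ^ d` rounds of the block, when all replays at smaller depths are over: thus a
replay never starts below a partially evicted coarser partition. -/
lemma Config.Regular.next {c₀ : ℝ} {T : ℕ} {h : Play} {tbl : ℕ → Config} {t : ℕ}
    (ht : (tbl t).Regular t) : (next c₀ T h tbl t).Regular (t + 1) := by
  unfold MDBE.next
  simp only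
  split_ifs with hempty hend
  · exact .fresh (by simp)
  · refine .fresh ?_
    rw [hend]
    simp
  · have hstart := ht.start_le
    refine ⟨by simp only; omega, ht.pow_level_le, ?_, ?_, ?_⟩
    · intro d k hk
      simp only at hk
      split_ifs at hk
      · simpa using hk
      · simp at hk
      · exact ht.lt_of_mem_bins d k (mem_kept.1 hk).1
    · intro d hd s hs
      simp only at hd hs ⊢
      split_ifs at hs with htrig hended
      · obtain rfl : t + 1 = s := by simpa using hs
        exact ⟨by omega, le_rfl, htrig.2.1⟩
      · simp at hs
      · have := ht.aligned d hd s hs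
        exact ⟨this.1, by omega, this.2.2⟩
    · intro d d' k hdd hd hd' hk
      rcases hdd.eq_or_lt with rfl | hlt
      · rwa [parent_self]
      rw [mem_depths] at hd hd'
      simp only at hd hd' hk ⊢
      have hk2 : k < 2 ^ d := by
        split_ifs at hk
        · simpa using hk
        · simp at hk
        · exact ht.lt_of_mem_bins d k (mem_kept.1 hk).1
      split_ifs with htrig' hended'
      · simpa using parent_lt hdd hk2
      · simp [htrig', hended'] at hd'
      · rw [if_neg htrig', if_neg hended'] at hd'
        obtain ⟨s, hs⟩ := Option.isSome_iff_exists.1 hd'.2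
        have hal := ht.aligned d' (hlt.trans_le hd.1) s hs
        have hnot : t + 1 < s + 8 ^ d' := by
          by_contra hcon
          exact hended' ⟨s, hs, not_lt.1 hcon⟩
        by_cases htrig : Triggered h (tbl t) (t + 1) d
        · exfalso
          have h1 : 8 ^ d' ∣ t + 1 - (tbl t).start := (pow_dvd_pow 8 hdd).trans htrig.2.1
          have h2 := Nat.dvd_sub h1 hal.2.2
          have h3 : t + 1 - (tbl t).start - (s - (tbl t).start) = t + 1 - s := by omega
          rw [h3] at h2
          have := Nat.le_of_dvd (by omega) h2
          omega
        · rw [if_neg htrig] at hk hd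
          split_ifs at hk hd with hended
          · simp at hk
          · rw [mem_kept] at hk ⊢
            refine ⟨ht.parent_mem d d' k hdd (mem_depths.2 hd) (mem_depths.2 hd') hk.1, ?_⟩
            exact fun he => hk.2 (he.of_parent hdd)

lemma config_succ (c₀ : ℝ) (T : ℕ) (h : Play) (t : ℕ) :
    config c₀ T h (t + 1) = next c₀ T h (table c₀ T h t) t := by
  simp [config, table]

lemma regular_config (c₀ : ℝ) (T : ℕ) (h : Play) {t : ℕ} (ht : 1 ≤ t) :
    (config c₀ T h t).Regular t := by
  induction t, ht using Nat.le_induction with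
  | base =>
    have : config c₀ T h 1 = fresh 1 1 := by
      rw [config_succ, next]
      simp [table, kept, idle]
    rw [this]
    exact .fresh (by simp)
  | succ t _ ih =>
    rw [config_succ]
    exact .next (tbl := table c₀ T h t) ih

/-- In every round, each active bin of depth `d` is played with probability at least `2⁻ᵈ`. -/
lemma le_armLaw_bin (c₀ : ℝ) (T : ℕ) (h : Play) {t : ℕ} (ht : 1 ≤ t) {d k : ℕ}
    (hd : d ∈ (config c₀ T h t).depths) (hk : k ∈ (config c₀ T h t).bins d) :
    ((2 : ℝ) ^ d)⁻¹ ≤ (armLaw (config c₀ T h t)).real (bin d k) := by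
  have hreg := regular_config c₀ T h ht
  set c := config c₀ T h t
  have hsorted : (0 :: c.depthList).Pairwise (· ≤ ·) := by
    rw [List.pairwise_cons]
    refine ⟨fun _ _ => Nat.zero_le _, List.Pairwise.filter _ ?_⟩
    exact List.pairwise_le_range
  have hdl : d ∈ c.depthList := by rwa [mem_depthList, ← mem_depths]
  have hpar0 : parent d 0 k = 0 := by
    simpa [parent] using Nat.div_eq_of_lt (hreg.lt_of_mem_bins d k hk)
  have hle := le_descend c hreg.lt_of_mem_bins d k c.depthList 0 hsorted
    (List.mem_cons_of_mem _ hdl) (fun d' hd' hdd => hreg.parent_mem d d' k hdd hd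
      (mem_depths.2 (mem_depthList.1 hd')) hk)
  rw [hpar0, Nat.sub_zero] at hle
  have hmono := ENNReal.toReal_mono (measure_ne_top (armLaw c) (bin d k)) hle
  simpa [Measure.real] using hmono

lemma two_pow_le_of_mem_depths {c₀ : ℝ} {T : ℕ} {h : Play} {t : ℕ} (ht : 1 ≤ t) {d : ℕ}
    (hd : d ∈ (config c₀ T h t).depths) : 2 ^ d ≤ 2 * t := by
  have hreg := regular_config c₀ T h ht
  have hd' := (mem_depths.1 hd).1
  calc 2 ^ d ≤ 2 ^ ((config c₀ T h t).level - 1 + 1) := Nat.pow_le_pow_right (by simp) (by omega)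
    _ = 2 * 2 ^ ((config c₀ T h t).level - 1) := by ring
    _ ≤ 2 * 8 ^ ((config c₀ T h t).level - 1) := by gcongr; simp
    _ ≤ 2 * t := by gcongr; exact hreg.pow_level_le.trans hreg.start_le

/-! ### Measurability of the states -/

section Measurability

variable {Ω α : Type*}

/-- `X` takes countably many values, each of them on an event of `m`.  This is measurability for
the discrete σ-algebra on `α`, without putting this σ-algebra on `α`. -/
structure CountablyMeasurable (m : MeasurableSpace Ω) (X : Ω → α) : Prop where
  countable_range : (Set.range X).Countable
  measurableSet_eq : ∀ a, MeasurableSet[m] {ω | X ω = a}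

lemma CountablyMeasurable.mono {m m' : MeasurableSpace Ω} (hm : m ≤ m') {X : Ω → α}
    (hX : CountablyMeasurable m X) : CountablyMeasurable m' X :=
  ⟨hX.1, fun a => hm _ (hX.2 a)⟩

lemma CountablyMeasurable.measurableSet {m : MeasurableSpace Ω} {X : Ω → α}
    (hX : CountablyMeasurable m X) {Q : α → Ω → Prop}
    (hQ : ∀ ω, MeasurableSet {ω' | Q (X ω) ω'}) : MeasurableSet {ω | Q (X ω) ω} := by
  have : {ω | Q (X ω) ω} = ⋃ a ∈ Set.range X, {ω | X ω = a} ∩ {ω | Q a ω} := by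
    ext ω
    simp only [Set.mem_iUnion₂, Set.mem_inter_iff, Set.mem_ofPred_eq]
    exact ⟨fun h => ⟨X ω, ⟨ω, rfl⟩, rfl, h⟩, by rintro ⟨_, _, rfl, h⟩; exact h⟩
  rw [this]
  refine MeasurableSet.biUnion hX.1 ?_
  rintro a ⟨ω, rfl⟩
  exact (hX.2 _).inter (hQ ω)

lemma CountablyMeasurable.measurable {β : Type*} [MeasurableSpace β] {m : MeasurableSpace Ω}
    {X : Ω → α} (hX : CountablyMeasurable m X) {f : α → Ω → β}
    (hf : ∀ ω, Measurable (f (X ω))) : Measurable fun ω => f (X ω) ω :=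
  fun _ hs => hX.measurableSet (Q := fun a ω => f a ω ∈ _) fun ω => hf ω hs

lemma measurable_muHatOf {m : MeasurableSpace Ω} {H : Ω → Play} {s : ℕ}
    (ha : Measurable fun ω => (H ω).arm s) (hr : Measurable fun ω => (H ω).reward s)
    (tbl : ℕ → Config) (d k : ℕ) : Measurable fun ω => muHatOf (H ω) tbl s d k := by
  unfold muHatOf
  exact Measurable.ite (ha (measurableSet_bin d k)) (hr.div_const _) measurable_const

lemma measurableSet_criterion {m : MeasurableSpace Ω} {H : Ω → Play} {t : ℕ}
    (ha : ∀ s ∈ Finset.Icc 1 t, Measurable fun ω => (H ω).arm s)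
    (hr : ∀ s ∈ Finset.Icc 1 t, Measurable fun ω => (H ω).reward s)
    (c₀ : ℝ) (T : ℕ) {tbl : ℕ → Config} (h₀ : tbl 0 = idle) (d k : ℕ) :
    MeasurableSet {ω | Criterion c₀ T (H ω) tbl t d k} := by
  unfold Criterion
  simp only [Set.ofPred_exists, Set.ofPred_and]
  refine .iUnion fun s₀ => .inter (.const _) (.iUnion fun s₁ => .iUnion fun s₂ =>
    .inter (.const _) (.inter (.const _) ?_))
  by_cases h2 : s₂ ≤ t
  swap
  · simp [h2]
  refine .inter (.const _) (.iUnion fun k' => ?_)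
  by_cases hk' : ∀ s ∈ Finset.Icc s₁ s₂, k' ∈ (tbl s).bins d
  swap
  · simp only [hk', Set.ofPred_false, Set.empty_inter, MeasurableSet.empty]
  refine .inter (.const _) (measurableSet_lt measurable_const ?_)
  refine Finset.measurable_sum _ fun s hs => ?_
  have hst : s ∈ Finset.Icc 1 t := by
    rw [Finset.mem_Icc] at hs ⊢
    refine ⟨Nat.one_le_iff_ne_zero.2 ?_, hs.2.trans h2⟩
    -- no bin is active in the fictitious round `0`
    rintro rfl
    simpa [h₀, idle] using hk' 0 (Finset.mem_Icc.2 hs)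
  exact (measurable_muHatOf (ha s hst) (hr s hst) tbl d k').sub
    (measurable_muHatOf (ha s hst) (hr s hst) tbl d k)

lemma measurableSet_mem_kept {m : MeasurableSpace Ω} {H : Ω → Play} {t : ℕ}
    (ha : ∀ s ∈ Finset.Icc 1 t, Measurable fun ω => (H ω).arm s)
    (hr : ∀ s ∈ Finset.Icc 1 t, Measurable fun ω => (H ω).reward s)
    (c₀ : ℝ) (T : ℕ) {tbl : ℕ → Config} (h₀ : tbl 0 = idle) (d k : ℕ) :
    MeasurableSet {ω | k ∈ kept c₀ T (H ω) tbl t d} := by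
  simp only [mem_kept, Evicted]
  refine .inter (.const _) (.compl ?_)
  change MeasurableSet {ω | ∃ d₀ ≤ d, d₀ ∈ (tbl t).depths ∧ parent d d₀ k ∈ (tbl t).bins d₀ ∧
    Criterion c₀ T (H ω) tbl t d₀ (parent d d₀ k)}
  simp only [Set.ofPred_exists, Set.ofPred_and]
  exact .iUnion fun d₀ => .inter (.const _) (.inter (.const _) (.inter (.const _)
    (measurableSet_criterion ha hr c₀ T h₀ _ _)))

lemma measurableSet_kept_eq {m : MeasurableSpace Ω} {H : Ω → Play} {t : ℕ}
    (ha : ∀ s ∈ Finset.Icc 1 t, Measurable fun ω => (H ω).arm s)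
    (hr : ∀ s ∈ Finset.Icc 1 t, Measurable fun ω => (H ω).reward s)
    (c₀ : ℝ) (T : ℕ) {tbl : ℕ → Config} (h₀ : tbl 0 = idle) (d : ℕ) (F : Finset ℕ) :
    MeasurableSet {ω | kept c₀ T (H ω) tbl t d = F} := by
  simp only [Finset.ext_iff, Set.ofPred_forall]
  refine .iInter fun k => ?_
  have hk := measurableSet_mem_kept ha hr c₀ T h₀ d k
  by_cases hF : k ∈ F
  · simpa only [hF, iff_true] using hk
  · simp only [hF, iff_false]
    exact hk.compl

lemma measurableSet_ite_eq {m : MeasurableSpace Ω} {p : Ω → Prop} [DecidablePred p]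
    (hp : MeasurableSet {ω | p ω}) {f g : Ω → α} {a : α} (hf : MeasurableSet {ω | f ω = a})
    (hg : MeasurableSet {ω | g ω = a}) :
    MeasurableSet {ω | (if p ω then f ω else g ω) = a} := by
  have : {ω | (if p ω then f ω else g ω) = a}
      = Set.ite {ω | p ω} {ω | f ω = a} {ω | g ω = a} := by
    ext ω
    by_cases h : p ω <;> simp [h, Set.ite]
  rw [this]
  exact hp.ite hf hg

lemma Config.ext_iff' {c c' : Config} : c = c' ↔ c.start = c'.start ∧ c.level = c'.level ∧
    (∀ d, c.replayStart d = c'.replayStart d) ∧ ∀ d, c.bins d = c'.bins d := by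
  cases c
  cases c'
  simp [funext_iff]

open Classical in
lemma measurableSet_next_eq {m : MeasurableSpace Ω} {H : Ω → Play} {t : ℕ}
    (hc : ∀ s ∈ Finset.Icc 1 t, Measurable fun ω => (H ω).coin s)
    (ha : ∀ s ∈ Finset.Icc 1 t, Measurable fun ω => (H ω).arm s)
    (hr : ∀ s ∈ Finset.Icc 1 t, Measurable fun ω => (H ω).reward s)
    (c₀ : ℝ) (T : ℕ) {tbl : ℕ → Config} (h₀ : tbl 0 = idle)
    (hstart : (tbl t).level = 0 ∨ (tbl t).start ∈ Finset.Icc 1 t) (c : Config) :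
    MeasurableSet {ω | next c₀ T (H ω) tbl t = c} := by
  have htrig (d : ℕ) : MeasurableSet {ω | Triggered (H ω) (tbl t) (t + 1) d} := by
    rcases hstart with hlev | hstart
    · simp [Triggered, hlev]
    · unfold Triggered
      refine .inter (.const _) (.inter (.const _) ?_)
      exact (measurable_pi_apply d).comp ((measurable_pi_apply _).comp (hc _ hstart))
        (measurableSet_singleton true)
  unfold next
  simp only
  refine measurableSet_ite_eq (measurableSet_kept_eq ha hr c₀ T h₀ _ _) (.const _)
    (measurableSet_ite_eq (.const _) (.const _) ?_)
  simp only [Config.ext_iff', Set.ofPred_and, Set.ofPred_forall]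
  refine .inter (.const _) (.inter (.const _) (.inter (.iInter fun d => ?_) (.iInter fun d => ?_)))
  · exact measurableSet_ite_eq (htrig d) (.const _) (.const _)
  · exact measurableSet_ite_eq (htrig d) (.const _)
      (measurableSet_ite_eq (.const _) (.const _) (measurableSet_kept_eq ha hr c₀ T h₀ _ _))

/-- Nothing is recorded at depths beyond the finest depth of the block. -/
def Config.Supported (c : Config) : Prop :=
  ∀ d, c.level < d → c.replayStart d = none ∧ c.bins d = ∅

lemma countable_supported : {c : Config | c.Supported}.Countable := by
  refine (Set.countable_range fun a : ℕ × ℕ × List (Option ℕ × Finset ℕ) =>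
    ({ start := a.1
       level := a.2.1
       replayStart := fun d => (a.2.2.getD d (none, ∅)).1
       bins := fun d => (a.2.2.getD d (none, ∅)).2 } : Config)).mono ?_
  intro c hc
  refine ⟨(c.start, c.level,
    (List.range (c.level + 1)).map fun d => (c.replayStart d, c.bins d)), ?_⟩
  have hget (d : ℕ) : ((List.range (c.level + 1)).map fun d => (c.replayStart d, c.bins d)).getD d
      (none, ∅) = (c.replayStart d, c.bins d) := by
    by_cases hd : d < c.level + 1
    · simp [List.getD, hd]
    · have := hc d (by omega)
      simp [List.getD, hd, this.1, this.2]
  simp only [hget]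

lemma Config.Supported.fresh (t m : ℕ) : (fresh t m).Supported := by
  intro d hd
  have : d ≠ m := (show m < d from hd).ne'
  simp [MDBE.fresh, this]

lemma Config.Supported.next {c₀ : ℝ} {T : ℕ} {h : Play} {tbl : ℕ → Config} {t : ℕ}
    (ht : (tbl t).Supported) : (next c₀ T h tbl t).Supported := by
  unfold MDBE.next
  simp only
  split_ifs
  · exact .fresh _ _
  · exact .fresh _ _
  · intro d hd
    have htrig : ¬ Triggered h (tbl t) (t + 1) d := fun h => absurd h.1 (not_lt.2 (le_of_lt hd))
    have hkept : kept c₀ T h tbl t d = ∅ := by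
      simp [kept, (ht d hd).2]
    simp [htrig, hkept, (ht d hd).1]

lemma supported_config (c₀ : ℝ) (T : ℕ) (h : Play) (t : ℕ) : (config c₀ T h t).Supported := by
  induction t with
  | zero => exact fun d _ => ⟨rfl, rfl⟩
  | succ t ih =>
    rw [config_succ]
    exact .next (tbl := table c₀ T h t) ih

lemma table_zero_right (c₀ : ℝ) (T : ℕ) (h : Play) (t : ℕ) : table c₀ T h t 0 = idle := by
  induction t with
  | zero => rfl
  | succ t ih => rw [table, Function.update_of_ne (by simp), ih]

lemma hist_mono (H : Ω → Play) : Monotone (hist H) := by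
  intro s t hst
  exact biSup_mono fun r hr => Finset.Icc_subset_Icc_right hst hr

lemma measurable_hist (H : Ω → Play) {s t : ℕ} (hs : s ∈ Finset.Icc 1 t) :
    Measurable[hist H t] (fun ω => (H ω).coin s) ∧ Measurable[hist H t] (fun ω => (H ω).arm s) ∧
      Measurable[hist H t] (fun ω => (H ω).reward s) := by
  have hle : coinSigma H s ⊔ armSigma H s ⊔ rewardSigma H s ≤ hist H t :=
    le_iSup₂ (f := fun s (_ : s ∈ Finset.Icc 1 t) =>
      coinSigma H s ⊔ armSigma H s ⊔ rewardSigma H s) s hs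
  rw [sup_le_iff, sup_le_iff] at hle
  exact ⟨measurable_iff_comap_le.2 hle.1.1, measurable_iff_comap_le.2 hle.1.2,
    measurable_iff_comap_le.2 hle.2⟩

/-- The states of the rounds up to `t` are determined by what happened before round `t`. -/
lemma countablyMeasurable_table (c₀ : ℝ) (T : ℕ) (H : Ω → Play) (t : ℕ) :
    CountablyMeasurable (hist H (t - 1)) fun ω => table c₀ T (H ω) t := by
  induction t with
  | zero =>
    refine ⟨(Set.countable_singleton fun _ => idle).mono ?_,
      fun a => .const ((fun _ => idle) = a)⟩
    rintro _ ⟨ω, rfl⟩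
    rfl
  | succ t ih =>
    have ih' := ih.mono (hist_mono H (Nat.sub_le t 1))
    rw [Nat.add_sub_cancel]
    constructor
    · refine ((ih.1.prod countable_supported).image
        fun p => Function.update p.1 (t + 1) p.2).mono ?_
      rintro _ ⟨ω, rfl⟩
      refine ⟨(table c₀ T (H ω) t, config c₀ T (H ω) (t + 1)),
        ⟨⟨ω, rfl⟩, supported_config c₀ T (H ω) (t + 1)⟩, ?_⟩
      simp only [config_succ, table]
    · intro a
      refine ih'.measurableSet (Q := fun tbl ω =>
        Function.update tbl (t + 1) (next c₀ T (H ω) tbl t) = a) fun ω => ?_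
      have hstart : (table c₀ T (H ω) t t).level = 0 ∨
          (table c₀ T (H ω) t t).start ∈ Finset.Icc 1 t := by
        rcases t.eq_zero_or_pos with rfl | ht
        · exact .inl rfl
        · have hreg := regular_config c₀ T (H ω) ht
          exact .inr (Finset.mem_Icc.2
            ⟨(Nat.one_le_pow _ _ (by simp)).trans hreg.pow_level_le, hreg.start_le⟩)
      have hnext := measurableSet_next_eq (fun s hs => (measurable_hist H hs).1)
        (fun s hs => (measurable_hist H hs).2.1) (fun s hs => (measurable_hist H hs).2.2) c₀ T
        (table_zero_right c₀ T (H ω) t) hstart (a (t + 1))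
      simp only [Function.update_eq_iff, Set.ofPred_and]
      exact hnext.inter (.const _)

lemma countablyMeasurable_config (c₀ : ℝ) (T : ℕ) (H : Ω → Play) (t : ℕ) :
    CountablyMeasurable (hist H (t - 1)) fun ω => config c₀ T (H ω) t := by
  have h := countablyMeasurable_table c₀ T H t
  refine ⟨(h.1.image fun tbl => tbl t).mono ?_, fun a =>
    h.measurableSet (Q := fun tbl _ => tbl t = a) fun _ => .const _⟩
  rintro _ ⟨ω, rfl⟩
  exact ⟨_, ⟨ω, rfl⟩, rfl⟩

end Measurability

/-! ### A Freedman-type inequality -/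

section Freedman

variable {Ω : Type*} {m₀ : MeasurableSpace Ω} {P : Measure Ω} [IsProbabilityMeasure P]

/-- One step of the exponential supermartingale: `exp x ≤ 1 + x + x ^ 2` for `|x| ≤ 1` bounds the
conditional expectation of `exp X` by `1 + P[X | G] + v ≤ exp (P[X | G] + v)`. -/
lemma integral_mul_exp_sub_condExp_le {G : MeasurableSpace Ω} (hG : G ≤ m₀) {X W : Ω → ℝ}
    {v K : ℝ} (hX : Measurable[m₀] X) (hX1 : ∀ᵐ ω ∂P, |X ω| ≤ 1)
    (hv : ∀ᵐ ω ∂P, (P[fun ω => X ω ^ 2 | G]) ω ≤ v)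
    (hW : StronglyMeasurable[G] W) (hW0 : ∀ ω, 0 ≤ W ω) (hWK : ∀ᵐ ω ∂P, W ω ≤ K) :
    ∫ ω, W ω * Real.exp (X ω - (P[X | G]) ω) ∂P ≤ Real.exp v * ∫ ω, W ω ∂P := by
  set C := P[X | G]
  have hC : StronglyMeasurable[G] C := stronglyMeasurable_condExp
  have hC1 : ∀ᵐ ω ∂P, |C ω| ≤ 1 := ae_bdd_abs_condExp_of_ae_bdd_abs hX1
  have hXint : Integrable X P := .of_bound hX.aestronglyMeasurable 1 hX1
  have hX2int : Integrable (fun ω => X ω ^ 2) P := by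
    refine .of_bound (hX.pow_const 2).aestronglyMeasurable 1 ?_
    filter_upwards [hX1] with ω h
    simpa using h
  set W' : Ω → ℝ := fun ω => W ω * Real.exp (-C ω)
  have hW' : StronglyMeasurable[G] W' :=
    hW.mul (Real.continuous_exp.comp_stronglyMeasurable hC.neg)
  have hW'0 (ω : Ω) : 0 ≤ W' ω := mul_nonneg (hW0 ω) (Real.exp_pos _).le
  have hW'K : ∀ᵐ ω ∂P, ‖W' ω‖ ≤ K * Real.exp 1 := by
    filter_upwards [hWK, hC1] with ω h1 h2
    rw [Real.norm_of_nonneg (hW'0 ω)]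
    exact mul_le_mul h1 (Real.exp_le_exp.2 (by linarith [(abs_le.1 h2).1])) (Real.exp_pos _).le
      ((hW0 ω).trans h1)
  set Y : Ω → ℝ := (fun _ => (1 : ℝ)) + X + fun ω => X ω ^ 2
  have hYint : Integrable Y P := ((integrable_const 1).add hXint).add hX2int
  have hW'Y : Integrable (fun ω => W' ω * Y ω) P :=
    hYint.bdd_mul (hW'.mono hG).aestronglyMeasurable hW'K
  have hcond : P[Y | G] ≤ᵐ[P] fun ω => Real.exp (C ω + v) := by
    have h1 := condExp_add ((integrable_const (μ := P) (1 : ℝ)).add hXint) hX2int G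
    have h2 := condExp_add (integrable_const (μ := P) (1 : ℝ)) hXint G
    filter_upwards [h1, h2, hv] with ω h1 h2 h3
    rw [h1, Pi.add_apply, h2, Pi.add_apply, condExp_const hG]
    exact le_trans (by linarith) (Real.add_one_le_exp _)
  have hWint : Integrable W P := by
    refine .of_bound (hW.mono hG).aestronglyMeasurable K ?_
    filter_upwards [hWK] with ω h
    rwa [Real.norm_of_nonneg (hW0 ω)]
  calc ∫ ω, W ω * Real.exp (X ω - C ω) ∂P ≤ ∫ ω, W' ω * Y ω ∂P := by
        refine integral_mono_of_nonneg (.of_forall fun ω => ?_) hW'Y ?_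
        · exact mul_nonneg (hW0 ω) (Real.exp_pos _).le
        · filter_upwards [hX1] with ω h
          have hexp : Real.exp (X ω) ≤ 1 + X ω + X ω ^ 2 := by
            have := (abs_le.1 (Real.abs_exp_sub_one_sub_id_le h)).2
            linarith
          calc W ω * Real.exp (X ω - C ω) = W' ω * Real.exp (X ω) := by
                simp only [W']
                rw [mul_assoc, ← Real.exp_add, neg_add_eq_sub]
            _ ≤ W' ω * Y ω := mul_le_mul_of_nonneg_left hexp (hW'0 ω)
    _ = ∫ ω, (P[fun ω => W' ω * Y ω | G]) ω ∂P := (integral_condExp hG).symm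
    _ = ∫ ω, W' ω * (P[Y | G]) ω ∂P :=
        integral_congr_ae (condExp_mul_of_stronglyMeasurable_left hW' hW'Y hYint)
    _ ≤ ∫ ω, Real.exp v * W ω ∂P := by
        refine integral_mono_ae
          (integrable_condExp.bdd_mul (hW'.mono hG).aestronglyMeasurable hW'K)
          (hWint.const_mul _) ?_
        filter_upwards [hcond] with ω h
        refine (mul_le_mul_of_nonneg_left h (hW'0 ω)).trans_eq ?_
        simp only [W']
        rw [mul_assoc, ← Real.exp_add, neg_add_cancel_left, mul_comm]
    _ = _ := integral_const_mul _ _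

variable {F : ℕ → MeasurableSpace Ω}

lemma integral_exp_sum_sub_condExp_le (hF : Monotone F) (hF₀ : ∀ t, F t ≤ m₀) {D : ℕ → Ω → ℝ}
    {T : ℕ} {v : ℝ} (hD : ∀ t ∈ Finset.Icc 1 T, Measurable[F t] (D t))
    (hD1 : ∀ t ∈ Finset.Icc 1 T, ∀ᵐ ω ∂P, |D t ω| ≤ 1)
    (hv : ∀ t ∈ Finset.Icc 1 T, ∀ᵐ ω ∂P, (P[fun ω => D t ω ^ 2 | F (t - 1)]) ω ≤ v)
    {s : ℕ} (hs : 1 ≤ s) (n : ℕ) (hn : s + n ≤ T + 1) :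
    Integrable (fun ω => Real.exp (∑ t ∈ Finset.Ico s (s + n),
      (D t ω - (P[D t | F (t - 1)]) ω))) P ∧
    ∫ ω, Real.exp (∑ t ∈ Finset.Ico s (s + n), (D t ω - (P[D t | F (t - 1)]) ω)) ∂P
      ≤ Real.exp (n * v) := by
  induction n with
  | zero => simp
  | succ n ih =>
    have hmem : s + n ∈ Finset.Icc 1 T := Finset.mem_Icc.2 ⟨by omega, by omega⟩
    have hIco : ∀ t ∈ Finset.Ico s (s + n), t ∈ Finset.Icc 1 T ∧ t ≤ s + n - 1 := by
      intro t ht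
      rw [Finset.mem_Ico] at ht
      exact ⟨Finset.mem_Icc.2 ⟨by omega, by omega⟩, by omega⟩
    have hincr (t : ℕ) (ht : t ∈ Finset.Icc 1 T) :
        ∀ᵐ ω ∂P, D t ω - (P[D t | F (t - 1)]) ω ≤ 2 := by
      filter_upwards [hD1 t ht, ae_bdd_abs_condExp_of_ae_bdd_abs (m := F (t - 1)) (hD1 t ht)]
        with ω h1 h2
      linarith [(abs_le.1 h1).2, (abs_le.1 h2).1]
    set W : Ω → ℝ := fun ω => Real.exp (∑ t ∈ Finset.Ico s (s + n),
      (D t ω - (P[D t | F (t - 1)]) ω))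
    have hW : StronglyMeasurable[F (s + n - 1)] W := by
      refine Real.continuous_exp.comp_stronglyMeasurable
        (Finset.stronglyMeasurable_fun_sum _ fun t ht => ?_)
      refine StronglyMeasurable.sub ?_ ?_
      · exact ((hD t (hIco t ht).1).mono (hF (hIco t ht).2) le_rfl).stronglyMeasurable
      · exact stronglyMeasurable_condExp.mono (hF ((Nat.sub_le _ _).trans (hIco t ht).2))
    have hWK : ∀ᵐ ω ∂P, W ω ≤ Real.exp (∑ t ∈ Finset.Ico s (s + n), 2) := by
      have hall := (ae_ball_iff (Finset.Ico s (s + n)).countable_toSet).2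
        fun t ht => hincr t (hIco t ht).1
      filter_upwards [hall] with ω h
      exact Real.exp_le_exp.2 (Finset.sum_le_sum h)
    have hprod (ω : Ω) : Real.exp (∑ t ∈ Finset.Ico s (s + (n + 1)),
          (D t ω - (P[D t | F (t - 1)]) ω))
        = W ω * Real.exp (D (s + n) ω - (P[D (s + n) | F (s + n - 1)]) ω) := by
      rw [← add_assoc, Finset.sum_Ico_succ_top (by omega), Real.exp_add]
    simp only [hprod]
    have hDm : Measurable (D (s + n)) := (hD _ hmem).mono (hF₀ _) le_rfl
    constructor
    · refine .of_bound (C := Real.exp (∑ t ∈ Finset.Ico s (s + n), 2) * Real.exp 2) ?_ ?_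
      · exact (hW.mono (hF₀ _)).aestronglyMeasurable.mul
          (Real.continuous_exp.comp_aestronglyMeasurable (hDm.aestronglyMeasurable.sub
            (stronglyMeasurable_condExp.mono (hF₀ _)).aestronglyMeasurable))
      · filter_upwards [hWK, hincr _ hmem] with ω h1 h2
        rw [Real.norm_of_nonneg (by positivity)]
        gcongr
    · calc _ ≤ Real.exp v * ∫ ω, W ω ∂P :=
            integral_mul_exp_sub_condExp_le (hF₀ _) hDm (hD1 _ hmem) (hv _ hmem) hW
              (fun ω => (Real.exp_pos _).le) hWK
        _ ≤ Real.exp v * Real.exp (n * v) := by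
            gcongr
            exact (ih (by omega)).2
        _ = _ := by
            rw [← Real.exp_add]
            congr 1
            push_cast
            ring

/-- Two-sided tail bound for sums of centred increments of size at most `r` and of conditional
second moment at most `v`. -/
lemma measureReal_le_abs_sum_sub_condExp_le (hF : Monotone F) (hF₀ : ∀ t, F t ≤ m₀)
    {D : ℕ → Ω → ℝ} {T : ℕ} {v r : ℝ} (hr : 0 < r)
    (hD : ∀ t ∈ Finset.Icc 1 T, Measurable[F t] (D t))
    (hDr : ∀ t ∈ Finset.Icc 1 T, ∀ᵐ ω ∂P, |D t ω| ≤ r)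
    (hv : ∀ t ∈ Finset.Icc 1 T, ∀ᵐ ω ∂P, (P[fun ω => D t ω ^ 2 | F (t - 1)]) ω ≤ v)
    {s : ℕ} (hs : 1 ≤ s) (n : ℕ) (hn : s + n ≤ T + 1) (a : ℝ) :
    P.real {ω | a * r ≤ |∑ t ∈ Finset.Ico s (s + n), (D t ω - (P[D t | F (t - 1)]) ω)|}
      ≤ 2 * Real.exp (n * v / r ^ 2 - a) := by
  -- the increments rescaled by `ε / r`, with a sign `ε`, satisfy the one-sided exponential bound
  have key (ε : ℝ) (hε : |ε| = 1) :
      P.real {ω | a ≤ ε / r * ∑ t ∈ Finset.Ico s (s + n), (D t ω - (P[D t | F (t - 1)]) ω)}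
        ≤ Real.exp (n * v / r ^ 2 - a) := by
    have hcond (t : ℕ) : P[fun ω => ε / r * D t ω | F (t - 1)]
        =ᵐ[P] fun ω => ε / r * (P[D t | F (t - 1)]) ω := condExp_smul (ε / r) (D t) _
    have hε2 : ε ^ 2 = 1 := by rw [← sq_abs, hε, one_pow]
    have hexp := integral_exp_sum_sub_condExp_le (P := P) (D := fun t ω => ε / r * D t ω)
      (v := v / r ^ 2) hF hF₀ (fun t ht => (hD t ht).const_mul _)
      (fun t ht => by
        filter_upwards [hDr t ht] with ω h
        rw [abs_mul, abs_div, hε, abs_of_pos hr, one_div, inv_mul_le_one₀ hr]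
        exact h)
      (fun t ht => by
        have hsq : (fun ω => (ε / r * D t ω) ^ 2) = (1 / r ^ 2) • fun ω => D t ω ^ 2 := by
          funext ω
          rw [Pi.smul_apply, smul_eq_mul, mul_pow, div_pow, hε2]
        rw [hsq]
        filter_upwards [hv t ht, condExp_smul (1 / r ^ 2) (fun ω => D t ω ^ 2) (F (t - 1))]
          with ω h1 h2
        rw [h2, Pi.smul_apply, smul_eq_mul, one_div_mul_eq_div]
        gcongr)
      hs n hn
    have hsum : ∀ᵐ ω ∂P, ∑ t ∈ Finset.Ico s (s + n),
          (ε / r * D t ω - (P[fun ω => ε / r * D t ω | F (t - 1)]) ω)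
        = ε / r * ∑ t ∈ Finset.Ico s (s + n), (D t ω - (P[D t | F (t - 1)]) ω) := by
      filter_upwards [ae_all_iff.2 hcond] with ω h
      rw [Finset.mul_sum]
      exact Finset.sum_congr rfl fun t _ => by rw [h t, mul_sub]
    rw [measureReal_congr (t := {ω | a ≤ ∑ t ∈ Finset.Ico s (s + n),
      (ε / r * D t ω - (P[fun ω => ε / r * D t ω | F (t - 1)]) ω)})]
    · refine (measure_ge_le_exp_mul_mgf a zero_le_one (by simpa using hexp.1)).trans ?_
      simp only [mgf, one_mul]
      calc _ ≤ Real.exp (-1 * a) * Real.exp (n * (v / r ^ 2)) := by gcongr; exact hexp.2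
        _ = _ := by
          rw [← Real.exp_add]
          congr 1
          ring
    · filter_upwards [hsum] with ω h
      exact propext (by change a ≤ _ ↔ a ≤ _; rw [h])
  calc _ ≤ P.real ({ω | a ≤ 1 / r * ∑ t ∈ Finset.Ico s (s + n),
            (D t ω - (P[D t | F (t - 1)]) ω)} ∪
          {ω | a ≤ -1 / r * ∑ t ∈ Finset.Ico s (s + n), (D t ω - (P[D t | F (t - 1)]) ω)}) := by
        refine measureReal_mono fun ω hω => ?_
        have hω' : a * r ≤ |∑ t ∈ Finset.Ico s (s + n), (D t ω - (P[D t | F (t - 1)]) ω)| := hω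
        change a ≤ _ ∨ a ≤ _
        rcases le_abs.1 hω' with h | h
        · left
          rwa [one_div_mul_eq_div, le_div_iff₀ hr]
        · right
          rwa [div_mul_eq_mul_div, neg_one_mul, le_div_iff₀ hr]
    _ ≤ _ := measureReal_union_le _ _
    _ ≤ _ := by linarith [key 1 (by simp), key (-1) (by simp)]

end Freedman

/-! ### Moments of the importance-weighted estimates -/

section ImportanceWeights

variable {Ω : Type*} {m₀ : MeasurableSpace Ω} {P : Measure Ω}

/-- If the conditional probability of `A` given `G` is `p`, then `p` is the density on `G` of the
restriction of `P` to `A`. -/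
lemma setLIntegral_eq_of_condExp_indicator [IsFiniteMeasure P] {G : MeasurableSpace Ω}
    (hG : G ≤ m₀) {A : Set Ω} (hA : MeasurableSet[m₀] A) {p : Ω → ℝ} (hp : Measurable[G] p)
    (hp0 : ∀ ω, 0 ≤ p ω) (hAp : P[A.indicator fun _ => (1 : ℝ) | G] =ᵐ[P] p)
    {W : Ω → ENNReal} (hW : Measurable[G] W) :
    ∫⁻ ω in A, W ω ∂P = ∫⁻ ω, ENNReal.ofReal (p ω) * W ω ∂P := by
  have hpE : Measurable[G] fun ω => ENNReal.ofReal (p ω) := hp.ennreal_ofReal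
  have hpint : Integrable p P := integrable_condExp.congr hAp
  have htrim : (P.restrict A).trim hG
      = (P.trim hG).withDensity fun ω => ENNReal.ofReal (p ω) := by
    ext s hs
    rw [withDensity_apply _ hs, trim_measurableSet_eq hG hs, Measure.restrict_apply (hG s hs),
      ← lintegral_indicator hs, lintegral_trim hG (hpE.indicator hs),
      lintegral_indicator (hG s hs),
      ← ofReal_integral_eq_lintegral_ofReal hpint.integrableOn (.of_forall hp0),
      ← setIntegral_congr_ae (hG s hs) (hAp.mono fun ω h _ => h),
      setIntegral_condExp hG ((integrable_const 1).indicator hA) hs,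
      setIntegral_indicator hA, setIntegral_const, smul_eq_mul, mul_one,
      ofReal_measureReal]
  calc ∫⁻ ω in A, W ω ∂P = ∫⁻ ω, W ω ∂((P.restrict A).trim hG) := (lintegral_trim hG hW).symm
    _ = ∫⁻ ω, ENNReal.ofReal (p ω) * W ω ∂(P.trim hG) := by
        rw [htrim, lintegral_withDensity_eq_lintegral_mul _ hpE hW]
        rfl
    _ = _ := lintegral_trim hG (hpE.mul hW)

end ImportanceWeights

section Trajectory

variable {Ω : Type*} {c₀ : ℝ} {T : ℕ} {H : Ω → Play}

/-- The probability, given the past, that the arm of round `t` lies in the bin `k` of depth `d`. -/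
noncomputable def binProb (c₀ : ℝ) (T : ℕ) (H : Ω → Play) (t d k : ℕ) (ω : Ω) : ℝ :=
  (armLaw (config c₀ T (H ω) t)).real (bin d k)

lemma measurable_binProb (c₀ : ℝ) (T : ℕ) (H : Ω → Play) (t d k : ℕ) :
    Measurable[hist H (t - 1)] (binProb c₀ T H t d k) :=
  (countablyMeasurable_config c₀ T H t).measurable (f := fun c _ => (armLaw c).real (bin d k))
    fun _ => measurable_const

/-- The event that the arm of round `t` lies in the bin `k` of depth `d`. -/
def armEvent (H : Ω → Play) (t d k : ℕ) : Set Ω := {ω | (H ω).arm t ∈ bin d k}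

lemma muHat_eq (c₀ : ℝ) (T : ℕ) (H : Ω → Play) (t d k : ℕ) (ω : Ω) :
    muHat c₀ T (H ω) t d k = (armEvent H t d k).indicator
      (fun ω => (H ω).reward t / binProb c₀ T H t d k ω) ω := by
  classical
  rw [Set.indicator_apply]
  exact if_congr Iff.rfl rfl rfl

lemma measurable_muHat (c₀ : ℝ) (T : ℕ) (H : Ω → Play) {t : ℕ} (ht : 1 ≤ t) (d k : ℕ) :
    Measurable[hist H t] fun ω => muHat c₀ T (H ω) t d k := by
  have hmem : t ∈ Finset.Icc 1 t := Finset.mem_Icc.2 ⟨ht, le_rfl⟩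
  exact ((countablyMeasurable_config c₀ T H t).mono (hist_mono H (Nat.sub_le t 1))).measurable
    (f := fun c ω => muHatOf (H ω) (fun _ => c) t d k)
    fun _ => measurable_muHatOf (measurable_hist H hmem).2.1 (measurable_hist H hmem).2.2 _ d k

/-- The event that the bin `k` of depth `d` is active in round `t`. -/
def activeEvent (c₀ : ℝ) (T : ℕ) (H : Ω → Play) (t d k : ℕ) : Set Ω :=
  {ω | d ∈ (config c₀ T (H ω) t).depths ∧ k ∈ (config c₀ T (H ω) t).bins d}

lemma measurableSet_activeEvent (c₀ : ℝ) (T : ℕ) (H : Ω → Play) (t d k : ℕ) :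
    MeasurableSet[hist H (t - 1)] (activeEvent c₀ T H t d k) :=
  (countablyMeasurable_config c₀ T H t).measurableSet
    (Q := fun c _ => d ∈ c.depths ∧ k ∈ c.bins d) fun _ => .const _

lemma inv_binProb_le {t : ℕ} (ht : 1 ≤ t) {d k : ℕ} {ω : Ω}
    (hω : ω ∈ activeEvent c₀ T H t d k) : (binProb c₀ T H t d k ω)⁻¹ ≤ 2 ^ d :=
  inv_le_of_inv_le₀ (by positivity) (le_armLaw_bin c₀ T (H ω) ht hω.1 hω.2)

/-- The estimated gap between the bins `k'` and `k` of depth `d`, set to `0` in the rounds in which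
one of these bins is not active. -/
noncomputable def gatedGap (c₀ : ℝ) (T : ℕ) (H : Ω → Play) (d k' k t : ℕ) : Ω → ℝ :=
  (activeEvent c₀ T H t d k' ∩ activeEvent c₀ T H t d k).indicator
    fun ω => deltaHat c₀ T (H ω) t d k' k

lemma measurable_gatedGap (c₀ : ℝ) (T : ℕ) (H : Ω → Play) (d k' k : ℕ) {t : ℕ} (ht : 1 ≤ t) :
    Measurable[hist H t] (gatedGap c₀ T H d k' k t) := by
  have hE (k : ℕ) : MeasurableSet[hist H t] (activeEvent c₀ T H t d k) :=
    hist_mono H (Nat.sub_le t 1) _ (measurableSet_activeEvent c₀ T H t d k)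
  exact ((measurable_muHat c₀ T H ht d k').sub (measurable_muHat c₀ T H ht d k)).indicator
    ((hE k').inter (hE k))

end Trajectory

section Run

variable {Ω : Type*} [m₀ : MeasurableSpace Ω] {P : Measure Ω} {c₀ : ℝ} {T : ℕ}
  {mean : ℕ → ℝ → ℝ} {H : Ω → Play}

lemma IsRun.coinSigma_le (hH : IsRun c₀ T mean P H) (t : ℕ) : coinSigma H t ≤ m₀ :=
  (hH.measurable_coin t).comap_le

lemma IsRun.hist_le (hH : IsRun c₀ T mean P H) (t : ℕ) : hist H t ≤ m₀ :=
  iSup₂_le fun s _ => sup_le (sup_le (hH.coinSigma_le s) (hH.measurable_arm s).comap_le)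
    (hH.measurable_reward s).comap_le

lemma IsRun.measurableSet_armEvent (hH : IsRun c₀ T mean P H) (t d k : ℕ) :
    MeasurableSet (armEvent H t d k) :=
  hH.measurable_arm t (measurableSet_bin d k)

lemma IsRun.condExp_armEvent [IsProbabilityMeasure P] (hH : IsRun c₀ T mean P H) {t : ℕ}
    (ht : t ∈ Finset.Icc 1 T) (d k : ℕ) :
    P[(armEvent H t d k).indicator fun _ => (1 : ℝ) | hist H (t - 1)]
      =ᵐ[P] binProb c₀ T H t d k := by
  have hle : hist H (t - 1) ⊔ coinSigma H t ≤ m₀ := sup_le (hH.hist_le _) (hH.coinSigma_le t)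
  have hp : Measurable[hist H (t - 1)] (binProb c₀ T H t d k) := measurable_binProb ..
  have hlaw := hH.arm_law t ht (bin d k) (measurableSet_bin d k)
  have hint : Integrable (binProb c₀ T H t d k) P := integrable_condExp.congr hlaw
  calc _ =ᵐ[P] P[P[(armEvent H t d k).indicator fun _ => (1 : ℝ) |
            hist H (t - 1) ⊔ coinSigma H t] | hist H (t - 1)] :=
        (condExp_condExp_of_le le_sup_left hle).symm
    _ =ᵐ[P] P[binProb c₀ T H t d k | hist H (t - 1)] := condExp_congr_ae hlaw
    _ = binProb c₀ T H t d k := condExp_of_stronglyMeasurable (hH.hist_le _)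
        hp.stronglyMeasurable hint

/-- The estimates are integrable whether or not their bin is active: on the event that the bin is
played, `1 / p` has integral at most `1`, where `p` is the conditional probability of the event. -/
lemma IsRun.integrable_muHat [IsProbabilityMeasure P] (hH : IsRun c₀ T mean P H) {t : ℕ}
    (ht : t ∈ Finset.Icc 1 T) (d k : ℕ) :
    Integrable (fun ω => muHat c₀ T (H ω) t d k) P := by
  have hmeas := (measurable_muHat c₀ T H (Finset.mem_Icc.1 ht).1 d k).mono (hH.hist_le t) le_rfl
  have hA := hH.measurableSet_armEvent t d k
  have hp : Measurable[hist H (t - 1)] (binProb c₀ T H t d k) := measurable_binProb ..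
  refine ⟨hmeas.aestronglyMeasurable, ?_⟩
  have hlint := setLIntegral_eq_of_condExp_indicator (hH.hist_le _) hA hp
    (fun _ => measureReal_nonneg) (hH.condExp_armEvent ht d k)
    (W := fun ω => ENNReal.ofReal (1 / binProb c₀ T H t d k ω))
    (hp.const_div 1).ennreal_ofReal
  calc ∫⁻ ω, ‖muHat c₀ T (H ω) t d k‖ₑ ∂P
      ≤ ∫⁻ ω, (armEvent H t d k).indicator
          (fun ω => ENNReal.ofReal (1 / binProb c₀ T H t d k ω)) ω ∂P := by
        refine lintegral_mono_ae ?_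
        filter_upwards [hH.reward_mem t ht] with ω hω
        rw [muHat_eq]
        by_cases h : ω ∈ armEvent H t d k
        · rw [Set.indicator_of_mem h, Set.indicator_of_mem h, Real.enorm_eq_ofReal_abs, abs_div,
            abs_of_nonneg hω.1, abs_of_nonneg (a := binProb c₀ T H t d k ω) measureReal_nonneg]
          exact ENNReal.ofReal_le_ofReal
            (div_le_div_of_nonneg_right hω.2 measureReal_nonneg)
        · simp [h]
    _ = ∫⁻ ω, ENNReal.ofReal (binProb c₀ T H t d k ω) *
          ENNReal.ofReal (1 / binProb c₀ T H t d k ω) ∂P := by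
        rw [lintegral_indicator hA, hlint]
    _ ≤ ∫⁻ _, 1 ∂P := by
        refine lintegral_mono fun ω => ?_
        have hp0 : 0 ≤ binProb c₀ T H t d k ω := measureReal_nonneg
        rw [← ENNReal.ofReal_mul hp0, mul_one_div]
        exact ENNReal.ofReal_le_one.2 (div_self_le_one _)
    _ < ⊤ := by simp

/-- The estimate of an active bin lies in `[0, 2ᵈ]`. -/
lemma IsRun.muHat_mem_Icc_of_active [IsProbabilityMeasure P] (hH : IsRun c₀ T mean P H) {t : ℕ}
    (ht : t ∈ Finset.Icc 1 T) (d k : ℕ) :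
    ∀ᵐ ω ∂P, ω ∈ activeEvent c₀ T H t d k →
      muHat c₀ T (H ω) t d k ∈ Set.Icc 0 ((2 : ℝ) ^ d) := by
  classical
  filter_upwards [hH.reward_mem t ht] with ω hω hact
  have hp0 : 0 ≤ binProb c₀ T H t d k ω := measureReal_nonneg
  rw [muHat_eq, Set.indicator_apply]
  split_ifs
  · refine ⟨div_nonneg hω.1 hp0, ?_⟩
    calc _ ≤ 1 / binProb c₀ T H t d k ω := div_le_div_of_nonneg_right hω.2 hp0
      _ ≤ 2 ^ d := by
        rw [one_div]
        exact inv_binProb_le (Finset.mem_Icc.1 ht).1 hact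
  · simp

/-- The conditional second moment of the estimate of an active bin is at most `1 / p ≤ 2ᵈ`, where
`p` is the conditional probability that the bin is played. -/
lemma IsRun.condExp_sq_indicator_muHat_le [IsProbabilityMeasure P] (hH : IsRun c₀ T mean P H)
    {t : ℕ} (ht : t ∈ Finset.Icc 1 T) (d k : ℕ) :
    P[fun ω => (activeEvent c₀ T H t d k).indicator (fun ω => muHat c₀ T (H ω) t d k) ω ^ 2 |
      hist H (t - 1)] ≤ᵐ[P] fun _ => (2 : ℝ) ^ d := by
  classical
  have ht1 := (Finset.mem_Icc.1 ht).1
  set E := activeEvent c₀ T H t d k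
  set A := armEvent H t d k
  set p := binProb c₀ T H t d k
  have hp0 (ω : Ω) : 0 ≤ p ω := measureReal_nonneg
  have hE : MeasurableSet[hist H (t - 1)] E := measurableSet_activeEvent c₀ T H t d k
  have hp : Measurable[hist H (t - 1)] p := measurable_binProb ..
  have hA := hH.measurableSet_armEvent t d k
  have hmeas := (measurable_muHat c₀ T H ht1 d k).mono (hH.hist_le t) le_rfl
  set q : Ω → ℝ := E.indicator fun ω => (p ω)⁻¹ ^ 2
  have hq : Measurable[hist H (t - 1)] q := (hp.inv.pow_const 2).indicator hE
  have hqb (ω : Ω) : ‖q ω‖ ≤ (2 ^ d) ^ 2 := by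
    simp only [q]
    rw [Set.indicator_apply]
    split_ifs with h
    · rw [Real.norm_of_nonneg (by positivity)]
      exact pow_le_pow_left₀ (inv_nonneg.2 (hp0 ω)) (inv_binProb_le ht1 h) 2
    · simp
  have h1A : Integrable (A.indicator fun _ => (1 : ℝ)) P := (integrable_const 1).indicator hA
  have hqA : Integrable (q * A.indicator fun _ => (1 : ℝ)) P :=
    h1A.bdd_mul (hq.mono (hH.hist_le _) le_rfl).aestronglyMeasurable (.of_forall hqb)
  have hsq : (fun ω => E.indicator (fun ω => muHat c₀ T (H ω) t d k) ω ^ 2)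
      ≤ᵐ[P] q * A.indicator fun _ => (1 : ℝ) := by
    filter_upwards [hH.reward_mem t ht] with ω hω
    rw [Pi.mul_apply]
    by_cases hωE : ω ∈ E
    · by_cases hωA : ω ∈ A
      · simp only [q]
        rw [Set.indicator_of_mem hωE, Set.indicator_of_mem hωE, muHat_eq,
          Set.indicator_of_mem hωA, Set.indicator_of_mem hωA, mul_one]
        refine pow_le_pow_left₀ (div_nonneg hω.1 (hp0 ω)) ?_ 2
        rw [← one_div]
        exact div_le_div_of_nonneg_right hω.2 (hp0 ω)
      · rw [Set.indicator_of_mem hωE, muHat_eq, Set.indicator_of_notMem hωA,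
          Set.indicator_of_notMem hωA]
        simp
    · simp [q, hωE]
  have hint : Integrable (fun ω => E.indicator (fun ω => muHat c₀ T (H ω) t d k) ω ^ 2) P := by
    refine hqA.mono' ((hmeas.indicator (hH.hist_le _ _ hE)).pow_const 2).aestronglyMeasurable ?_
    filter_upwards [hsq] with ω h
    rwa [Real.norm_of_nonneg (sq_nonneg _)]
  filter_upwards [condExp_mono (m := hist H (t - 1)) hint hqA hsq,
    condExp_mul_of_stronglyMeasurable_left hq.stronglyMeasurable hqA h1A,
    hH.condExp_armEvent ht d k] with ω h1 h2 h3
  refine h1.trans ?_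
  rw [h2, Pi.mul_apply, h3]
  change q ω * p ω ≤ _
  simp only [q]
  rw [Set.indicator_apply]
  split_ifs with h
  · have hpos : 0 < p ω := lt_of_lt_of_le (by positivity) (le_armLaw_bin c₀ T (H ω) ht1 h.1 h.2)
    calc (p ω)⁻¹ ^ 2 * p ω = (p ω)⁻¹ := by field_simp
      _ ≤ 2 ^ d := inv_binProb_le ht1 h
  · simp

lemma IsRun.abs_gatedGap_le [IsProbabilityMeasure P] (hH : IsRun c₀ T mean P H) (d k' k : ℕ)
    {t : ℕ} (ht : t ∈ Finset.Icc 1 T) : ∀ᵐ ω ∂P, |gatedGap c₀ T H d k' k t ω| ≤ 2 ^ d := by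
  classical
  filter_upwards [hH.muHat_mem_Icc_of_active ht d k', hH.muHat_mem_Icc_of_active ht d k] with ω h' h
  rw [gatedGap, Set.indicator_apply]
  split_ifs with hω
  · have h1 := h' hω.1
    have h2 := h hω.2
    rw [deltaHat, abs_le]
    exact ⟨by linarith [h1.1, h2.2], by linarith [h1.2, h2.1]⟩
  · simp

lemma IsRun.condExp_sq_gatedGap_le [IsProbabilityMeasure P] (hH : IsRun c₀ T mean P H)
    (d k' k : ℕ) {t : ℕ} (ht : t ∈ Finset.Icc 1 T) :
    ∀ᵐ ω ∂P, (P[fun ω => gatedGap c₀ T H d k' k t ω ^ 2 | hist H (t - 1)]) ω ≤ 2 * 2 ^ d := by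
  classical
  have ht1 := (Finset.mem_Icc.1 ht).1
  set U : ℕ → Ω → ℝ := fun j ω =>
    (activeEvent c₀ T H t d j).indicator (fun ω => muHat c₀ T (H ω) t d j) ω ^ 2
  have hUint (j : ℕ) : Integrable (U j) P := by
    have hm : Measurable (U j) :=
      (((measurable_muHat c₀ T H ht1 d j).mono (hH.hist_le t) le_rfl).indicator
        (hH.hist_le _ _ (measurableSet_activeEvent c₀ T H t d j))).pow_const 2
    refine .of_bound hm.aestronglyMeasurable ((2 ^ d) ^ 2) ?_
    filter_upwards [hH.muHat_mem_Icc_of_active ht d j] with ω h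
    simp only [U]
    rw [Real.norm_of_nonneg (sq_nonneg _), Set.indicator_apply]
    split_ifs with hω
    · exact pow_le_pow_left₀ (h hω).1 (h hω).2 2
    · simp only [ne_eq, OfNat.ofNat_ne_zero, not_false_eq_true, zero_pow]
      positivity
  have hle : (fun ω => gatedGap c₀ T H d k' k t ω ^ 2) ≤ᵐ[P] U k' + U k := by
    filter_upwards [hH.muHat_mem_Icc_of_active ht d k', hH.muHat_mem_Icc_of_active ht d k] with ω h' h
    by_cases hω : ω ∈ activeEvent c₀ T H t d k' ∩ activeEvent c₀ T H t d k
    · simp only [gatedGap, U, Pi.add_apply]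
      rw [Set.indicator_of_mem hω, Set.indicator_of_mem hω.1, Set.indicator_of_mem hω.2, deltaHat]
      nlinarith [mul_nonneg (h' hω.1).1 (h hω.2).1]
    · simp only [gatedGap, U, Pi.add_apply]
      rw [Set.indicator_of_notMem hω, zero_pow two_ne_zero]
      positivity
  have hint : Integrable (fun ω => gatedGap c₀ T H d k' k t ω ^ 2) P := by
    refine ((hUint k').add (hUint k)).mono'
      (((measurable_gatedGap c₀ T H d k' k ht1).mono (hH.hist_le t) le_rfl).pow_const
        2).aestronglyMeasurable ?_
    filter_upwards [hle] with ω h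
    rwa [Real.norm_of_nonneg (sq_nonneg _)]
  filter_upwards [condExp_mono (m := hist H (t - 1)) hint ((hUint k').add (hUint k)) hle,
    condExp_add (hUint k') (hUint k) (hist H (t - 1)),
    hH.condExp_sq_indicator_muHat_le ht d k', hH.condExp_sq_indicator_muHat_le ht d k]
    with ω h1 h2 h3 h4
  rw [h2, Pi.add_apply] at h1
  linarith

/-- Since activity in round `t` is decided before this round, gating the gap does not affect its
conditional expectation where both bins are active. -/
lemma IsRun.condExp_gatedGap [IsProbabilityMeasure P] (hH : IsRun c₀ T mean P H) (d k' k : ℕ)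
    {t : ℕ} (ht : t ∈ Finset.Icc 1 T) :
    P[gatedGap c₀ T H d k' k t | hist H (t - 1)] =ᵐ[P]
      (activeEvent c₀ T H t d k' ∩ activeEvent c₀ T H t d k).indicator
        (P[fun ω => deltaHat c₀ T (H ω) t d k' k | hist H (t - 1)]) :=
  condExp_indicator ((hH.integrable_muHat ht d k').sub (hH.integrable_muHat ht d k))
    ((measurableSet_activeEvent c₀ T H t d k').inter (measurableSet_activeEvent c₀ T H t d k))

/-! ### Concentration -/

/-- The scale `√((s₂ - s₁) 2ᵈ ∨ 4ᵈ)` of the fluctuations over the rounds `s₁, …, s₂` of the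
estimated gaps at depth `d`. -/
noncomputable def scale (s₁ s₂ d : ℕ) : ℝ := Real.sqrt (max (((s₂ : ℝ) - s₁) * 2 ^ d) (4 ^ d))

lemma two_pow_le_scale (s₁ s₂ d : ℕ) : 2 ^ d ≤ scale s₁ s₂ d := by
  refine Real.le_sqrt_of_sq_le ?_
  rw [← pow_mul, mul_comm, pow_mul]
  norm_num

/-- The event that the sum over the rounds `s₁, …, s₂` of the centred gated gaps is large. -/
def deviationEvent (c₀ c₁ : ℝ) (T : ℕ) (P : Measure Ω) (H : Ω → Play) (s₁ s₂ d k' k : ℕ) :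
    Set Ω :=
  {ω | c₁ * Real.log T * scale s₁ s₂ d ≤ |∑ t ∈ Finset.Icc s₁ s₂,
    (gatedGap c₀ T H d k' k t ω - (P[gatedGap c₀ T H d k' k t | hist H (t - 1)]) ω)|}

lemma IsRun.measureReal_deviationEvent_le [IsProbabilityMeasure P] (hH : IsRun c₀ T mean P H)
    (c₁ : ℝ) {s₁ s₂ : ℕ} (h₁ : 1 ≤ s₁) (h₁₂ : s₁ ≤ s₂) (h₂ : s₂ ≤ T) (d k' k : ℕ) :
    P.real (deviationEvent c₀ c₁ T P H s₁ s₂ d k' k) ≤ 2 * Real.exp (4 - c₁ * Real.log T) := by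
  set R := scale s₁ s₂ d
  have hR : 2 ^ d ≤ R := two_pow_le_scale s₁ s₂ d
  have hR0 : 0 < R := lt_of_lt_of_le (by positivity) hR
  have hIcc : Finset.Icc s₁ s₂ = Finset.Ico s₁ (s₁ + (s₂ - s₁ + 1)) := by
    ext t
    simp only [Finset.mem_Icc, Finset.mem_Ico]
    omega
  have htail := measureReal_le_abs_sum_sub_condExp_le (P := P) (hist_mono H) hH.hist_le hR0
    (D := gatedGap c₀ T H d k' k) (T := T)
    (fun t ht => measurable_gatedGap c₀ T H d k' k (Finset.mem_Icc.1 ht).1)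
    (fun t ht => (hH.abs_gatedGap_le d k' k ht).mono fun ω h => h.trans hR)
    (fun t ht => hH.condExp_sq_gatedGap_le d k' k ht) h₁ (s₂ - s₁ + 1) (by omega)
    (c₁ * Real.log T)
  rw [deviationEvent, hIcc]
  refine htail.trans ?_
  have hR2 : R ^ 2 = max (((s₂ : ℝ) - s₁) * 2 ^ d) (4 ^ d) :=
    Real.sq_sqrt (le_max_of_le_right (by positivity))
  gcongr
  rw [div_le_iff₀ (by positivity), hR2]
  push_cast [Nat.cast_sub h₁₂]
  have h24 : (2 : ℝ) ^ d ≤ 4 ^ d := pow_le_pow_left₀ (by norm_num) (by norm_num) d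
  linarith [le_max_left (((s₂ : ℝ) - s₁) * 2 ^ d) (4 ^ d),
    le_max_right (((s₂ : ℝ) - s₁) * 2 ^ d) ((4 : ℝ) ^ d)]

/-- Rounds `s₁`, `s₂`, a depth `d` and two bins `k'`, `k` of this depth, up to time `T`.  Active
depths satisfy `2 ^ d ≤ 2 * T`, which bounds the depth and the numbers of the bins. -/
def comparisons (T : ℕ) : Finset (ℕ × ℕ × ℕ × ℕ × ℕ) :=
  ((Finset.Icc 1 T ×ˢ Finset.Icc 1 T ×ˢ Finset.range (2 * T) ×ˢ Finset.range (2 * T) ×ˢ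
    Finset.range (2 * T))).filter fun x => x.1 ≤ x.2.1

lemma card_comparisons_le (T : ℕ) : (comparisons T).card ≤ 8 * T ^ 5 := by
  refine (Finset.card_filter_le _ _).trans_eq ?_
  simp only [Finset.card_product, Nat.card_Icc, Finset.card_range]
  rw [Nat.add_sub_cancel]
  ring

lemma mem_concentrationEvent {c₁ : ℝ} {ω : Ω}
    (hgate : ∀ t ∈ Finset.Icc 1 T, ∀ d k' k : ℕ,
      (P[gatedGap c₀ T H d k' k t | hist H (t - 1)]) ω =
        (activeEvent c₀ T H t d k' ∩ activeEvent c₀ T H t d k).indicator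
          (P[fun ω => deltaHat c₀ T (H ω) t d k' k | hist H (t - 1)]) ω)
    (hdev : ∀ x ∈ comparisons T,
      ω ∉ deviationEvent c₀ c₁ T P H x.1 x.2.1 x.2.2.1 x.2.2.2.1 x.2.2.2.2) :
    ω ∈ concentrationEvent c₀ c₁ T P H := by
  intro s₁ s₂ h₁ h₁₂ h₂ d hd k k' hk hk'
  have hs₁ : s₁ ∈ Finset.Icc s₁ s₂ := Finset.mem_Icc.2 ⟨le_rfl, h₁₂⟩
  have hpow : 2 ^ d ≤ 2 * T :=
    (two_pow_le_of_mem_depths h₁ (hd s₁ hs₁)).trans (by omega)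
  have hlt (j : ℕ) (hj : j ∈ (config c₀ T (H ω) s₁).bins d) : j < 2 * T :=
    ((regular_config c₀ T (H ω) h₁).lt_of_mem_bins d j hj).trans_le hpow
  have hmem : (s₁, s₂, d, k', k) ∈ comparisons T := by
    simp only [comparisons, Finset.mem_filter, Finset.mem_product, Finset.mem_Icc,
      Finset.mem_range]
    exact ⟨⟨⟨h₁, h₁₂.trans h₂⟩, ⟨h₁.trans h₁₂, h₂⟩, d.lt_two_pow_self.trans_le hpow,
      hlt k' (hk' s₁ hs₁), hlt k (hk s₁ hs₁)⟩, h₁₂⟩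
  have hsmall := hdev _ hmem
  have hsum : ∑ t ∈ Finset.Icc s₁ s₂,
      (gatedGap c₀ T H d k' k t ω - (P[gatedGap c₀ T H d k' k t | hist H (t - 1)]) ω)
      = ∑ t ∈ Finset.Icc s₁ s₂, deltaHat c₀ T (H ω) t d k' k
        - ∑ t ∈ Finset.Icc s₁ s₂,
            (P[fun ω' => deltaHat c₀ T (H ω') t d k' k | hist H (t - 1)]) ω := by
    rw [← Finset.sum_sub_distrib]
    refine Finset.sum_congr rfl fun t ht => ?_
    have hact : ω ∈ activeEvent c₀ T H t d k' ∩ activeEvent c₀ T H t d k :=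
      ⟨⟨hd t ht, hk' t ht⟩, hd t ht, hk t ht⟩
    rw [hgate t (Finset.Icc_subset_Icc h₁ h₂ ht) d k' k, Set.indicator_of_mem hact, gatedGap,
      Set.indicator_of_mem hact]
  rw [deviationEvent, Set.mem_ofPred_eq, not_le, hsum] at hsmall
  exact hsmall.le

lemma IsRun.compl_concentrationEvent_ae_le [IsProbabilityMeasure P]
    (hH : IsRun c₀ T mean P H) (c₁ : ℝ) :
    ((concentrationEvent c₀ c₁ T P H)ᶜ : Set Ω) ≤ᵐ[P]
      (⋃ x ∈ comparisons T,
        deviationEvent c₀ c₁ T P H x.1 x.2.1 x.2.2.1 x.2.2.2.1 x.2.2.2.2 : Set Ω) := by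
  have hae : ∀ᵐ ω ∂P, ∀ t ∈ Finset.Icc 1 T, ∀ d k' k : ℕ,
      (P[gatedGap c₀ T H d k' k t | hist H (t - 1)]) ω =
        (activeEvent c₀ T H t d k' ∩ activeEvent c₀ T H t d k).indicator
          (P[fun ω => deltaHat c₀ T (H ω) t d k' k | hist H (t - 1)]) ω := by
    refine (ae_ball_iff (Finset.Icc 1 T).countable_toSet).2 fun t ht => ?_
    simp only [ae_all_iff]
    exact fun d k' k => hH.condExp_gatedGap d k' k ht
  filter_upwards [hae] with ω hgate hω
  by_contra hdev
  refine hω (mem_concentrationEvent hgate fun x hx h => hdev ?_)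
  exact Set.mem_iUnion₂.2 ⟨x, hx, h⟩

lemma IsRun.measureReal_compl_concentrationEvent_le [IsProbabilityMeasure P]
    (hH : IsRun c₀ T mean P H) (hT : 2 ≤ T) :
    P.real (concentrationEvent c₀ 18 T P H)ᶜ ≤ 1 / (T : ℝ) ^ 3 := by
  have hT2 : (2 : ℝ) ≤ T := by exact_mod_cast hT
  have hT0 : (0 : ℝ) < T := by linarith
  have hexp : 2 * Real.exp (4 - 18 * Real.log T) ≤ 1 / (T : ℝ) ^ 11 := by
    have hpow : Real.exp (18 * Real.log T) = (T : ℝ) ^ 18 := by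
      rw [show (18 : ℝ) = ((18 : ℕ) : ℝ) by norm_num, Real.exp_nat_mul, Real.exp_log hT0]
    have he4 : 2 * Real.exp 4 ≤ 2 ^ 7 := by
      have h1 : Real.exp 4 = Real.exp 1 ^ 4 := by rw [← Real.exp_nat_mul]; norm_num
      have h2 : Real.exp 1 ^ 4 ≤ 2.7182818286 ^ 4 :=
        pow_le_pow_left₀ (Real.exp_pos 1).le Real.exp_one_lt_d9.le 4
      rw [h1]
      norm_num at h2 ⊢
      linarith
    rw [Real.exp_sub, hpow, ← mul_div_assoc, div_le_div_iff₀ (by positivity) (by positivity),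
      one_mul]
    calc 2 * Real.exp 4 * (T : ℝ) ^ 11 ≤ (T : ℝ) ^ 7 * (T : ℝ) ^ 11 := by
          gcongr
          exact he4.trans (pow_le_pow_left₀ (by norm_num) hT2 7)
      _ = (T : ℝ) ^ 18 := by ring
  calc P.real (concentrationEvent c₀ 18 T P H)ᶜ
      ≤ P.real (⋃ x ∈ comparisons T,
          deviationEvent c₀ 18 T P H x.1 x.2.1 x.2.2.1 x.2.2.2.1 x.2.2.2.2) :=
        ENNReal.toReal_mono (measure_ne_top _ _)
          (measure_mono_ae (hH.compl_concentrationEvent_ae_le 18))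
    _ ≤ ∑ x ∈ comparisons T,
          P.real (deviationEvent c₀ 18 T P H x.1 x.2.1 x.2.2.1 x.2.2.2.1 x.2.2.2.2) :=
        measureReal_biUnion_finset_le _ _
    _ ≤ ∑ _x ∈ comparisons T, 1 / (T : ℝ) ^ 11 := by
        refine Finset.sum_le_sum fun x hx => ?_
        simp only [comparisons, Finset.mem_filter, Finset.mem_product, Finset.mem_Icc] at hx
        exact (hH.measureReal_deviationEvent_le 18 hx.1.1.1 hx.2 hx.1.2.1.2 _ _ _).trans hexp
    _ ≤ (T : ℝ) ^ 3 * (T : ℝ) ^ 5 * (1 / (T : ℝ) ^ 11) := by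
        rw [Finset.sum_const, nsmul_eq_mul]
        gcongr
        calc ((comparisons T).card : ℝ) ≤ 8 * (T : ℝ) ^ 5 := by
              exact_mod_cast card_comparisons_le T
          _ ≤ (T : ℝ) ^ 3 * (T : ℝ) ^ 5 := by
              gcongr
              calc (8 : ℝ) = 2 ^ 3 := by norm_num
                _ ≤ (T : ℝ) ^ 3 := pow_le_pow_left₀ (by norm_num) hT2 3
    _ = 1 / (T : ℝ) ^ 3 := by field_simp

end Run

end MDBE

/-- There is a numerical constant `c₁ > 0` such that, for every horizon, every Lipschitz
environment and every run of the algorithm (whatever the constant `c₀ > 0` of its eviction rule),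
the concentration event has probability at least `1 - 1 / T ^ 3`. -/
theorem proposition3 :
    ∃ c₁ : ℝ, 0 < c₁ ∧
      ∀ (c₀ : ℝ) (_ : 0 < c₀) (T : ℕ) (_ : 1 ≤ T)
        (mean : ℕ → ℝ → ℝ) (_ : MDBE.IsLipschitzEnv T mean)
        (Ω : Type*) [MeasurableSpace Ω] (P : Measure Ω) [IsProbabilityMeasure P]
        (H : Ω → MDBE.Play) (_ : MDBE.IsRun c₀ T mean P H),
        1 - 1 / (T : ℝ) ^ 3 ≤ P.real (MDBE.concentrationEvent c₀ c₁ T P H) := by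
  refine ⟨18, by norm_num, fun c₀ _ T hT mean _ Ω _ P _ H hH => ?_⟩
  rcases hT.eq_or_lt with rfl | hT2
  · simp
  -- the concentration event need not be measurable, but outer measures are subadditive
  have hunion := measureReal_union_le (μ := P) (MDBE.concentrationEvent c₀ 18 T P H)
    (MDBE.concentrationEvent c₀ 18 T P H)ᶜ
  rw [Set.union_compl_self, probReal_univ] at hunion
  linarith [hH.measureReal_compl_concentrationEvent_le hT2]
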